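/- Let $\mathcal E$ be a category with all pullbacks and all coequalisers, such that coequalisers are preserved by pullback (for every $f\colon X\to Y$ the pullback functor $f^*\colon\mathcal E/Y\to\mathcal E/X$ preserves coequalisers). Let $\mathrm{Prof}(\mathcal E)$ be the following equipment (double category with companions and conjoints). * Objects are categories $A$ internal in $\mathcal E$ (a span $A_0\xleftarrow{d_0}A\xrightarrow{d_1}A_0$ with an associative and unital multiplication $A\times_{A_0}A\to A$ and unit $A_0\to A$); vertical morphisms are internal functors. * Horizontal morphisms $J\colon A\nrightarrow B$ are internal profunctors: spans $A_0\xleftarrow{d_0}J\xrightarrow{d_1}B_0$ with actions $A\times_{A_0}J\to J$ and $J\times_{B_0}B\to J$ that are associative, unital and commute with each other. The unit $1_A$ is $A$ acting on itself. The composite $J\odot H$ of $J\colon A\nrightarrow B$ and $H\colon B\nrightarrow C$ is the coequaliser of the two maps $J\times_{B_0}B\times_{B_0}H\rightrightarrows J\times_{B_0}H$ given by the actions of $B$, with the induced actions of $A$ and $C$. * A cell $J\Rightarrow K$ with vertical source $f\colon A\to C$ and vertical target $g\colon B\to D$, where $J\colon A\nrightarrow B$ and $K\colon C\nrightarrow D$,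 is an internal transformation: a map $J\to K$ in $\mathcal E$ over $f_0$ and $g_0$ that is compatible with the actions. Cells compose vertically ($\psi\circ\phi$) as maps of $\mathcal E$, and horizontally ($\phi\odot\chi$) via the universal property of the coequalisers, which also gives the associators and unitors. The horizontal unit cell $1_f\colon 1_A\Rightarrow 1_C$ of $f\colon A\to C$ is given by the action of $f$ on morphisms. * The companion of $f\colon A\to C$ is $f_*=A_0\times_{C_0}C$ (pullback of $f_0$ and $d_0$), and its conjoint is $f^*=C\times_{C_0}A_0$ (pullback of $d_1$ and $f_0$). Then every internal profunctor $J\colon A\nrightarrow B$ admits an opcartesian tabulation: there are an internal category $\langle J\rangle$, internal functors $\pi_A\colon\langle J\rangle\to A$ and $\pi_B\colon\langle J\rangle\to B$, and a cell $\pi\colon 1_{\langle J\rangle}\Rightarrow J$ with vertical source $\pi_A$ and vertical target $\pi_B$, such that: 1. (1-dimensional property) for every cell $\phi\colon 1_X\Rightarrow J$ with vertical source $\phi_A\colon X\to A$ and vertical target $\phi_B\colon X\to B$ there is a unique internal functor $\phi'\colon X\to\langle J\rangle$ with $\pi\circ 1_{\phi'}=\phi$ (strictly; so in particular $\pi_A\circ\phi'=\phi_A$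 and $\pi_B\circ\phi'=\phi_B$); 2. (2-dimensional property) let $\phi\colon 1_X\Rightarrow J$ and $\psi\colon 1_Y\Rightarrow J$ be cells with vertical sources $\phi_A,\psi_A$ and vertical targets $\phi_B,\psi_B$, that factor as $\phi=\pi\circ 1_{\phi'}$ and $\psi=\pi\circ 1_{\psi'}$, and let $H\colon X\nrightarrow Y$ be an internal profunctor. For all cells $\xi_A\colon H\Rightarrow 1_A$, with vertical source $\phi_A$ and target $\psi_A$, and $\xi_B\colon H\Rightarrow 1_B$, with vertical source $\phi_B$ and target $\psi_B$, such that $\xi_A\odot\psi=\phi\odot\xi_B$ (as cells $H\Rightarrow J$, via the unitors), there is a unique cell $\xi'\colon H\Rightarrow 1_{\langle J\rangle}$, with vertical source $\phi'$ and target $\psi'$, such that $1_{\pi_A}\circ\xi'=\xi_A$ and $1_{\pi_B}\circ\xi'=\xi_B$ (strictly); 3. ($\pi$ is opcartesian) for all internal functors $h\colon A\to C$ and $k\colon B\to D$, every internal profunctor $L\colon C\nrightarrow D$ and every cell $\chi\colon 1_{\langle J\rangle}\Rightarrow L$ with vertical source $h\circ\pi_A$ and vertical target $k\circ\pi_B$,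 there is a unique cell $\chi'\colon J\Rightarrow L$ with vertical source $h$ and vertical target $k$ such that $\chi'\circ\pi=\chi$. -/

import Mathlib

open CategoryTheory CategoryTheory.Limits

set_option linter.checkUnivs false

universe w₁ w₂ w₃ w₄ v u

noncomputable section

/-- A (pseudo) double category: objects, vertical morphisms (the category structure on `Obj`),
horizontal morphisms `Hor A B`, and square cells with vertical source `f : A ⟶ C`, vertical target
`g : B ⟶ D`, horizontal source `J : Hor A B` and horizontal target `K : Hor C D`,
forming the type `Cell f g J K`. The cells compose strictly vertically (`vcomp φ ψ` is `φ` on top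
of `ψ`), and horizontally up to the invertible cells `assoc`, `lunit` and `runit`.
Equality of cells whose vertical boundaries agree only propositionally is expressed by `≍`. -/
structure DoubleCategory where
  /-- objects -/
  Obj : Type w₁
  /-- vertical morphisms -/
  [vert : Category.{w₂} Obj]
  /-- horizontal morphisms -/
  Hor : Obj → Obj → Type w₃
  /-- cells, indexed by vertical source and target, and horizontal source and target -/
  Cell : ∀ {A B C D : Obj}, (A ⟶ C) → (B ⟶ D) → Hor A B → Hor C D → Type w₄
  /-- vertical identity cell -/
  vid : ∀ {A B : Obj} (J : Hor A B), Cell (𝟙 A) (𝟙 B) J J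
  /-- vertical composition of cells -/
  vcomp : ∀ {A B C D X Y : Obj} {f : A ⟶ C} {g : B ⟶ D} {h : C ⟶ X} {k : D ⟶ Y}
    {J : Hor A B} {K : Hor C D} {L : Hor X Y},
    Cell f g J K → Cell h k K L → Cell (f ≫ h) (g ≫ k) J L
  vid_vcomp : ∀ {A B C D : Obj} {f : A ⟶ C} {g : B ⟶ D} {J : Hor A B} {K : Hor C D}
    (φ : Cell f g J K), vcomp (vid J) φ ≍ φ
  vcomp_vid : ∀ {A B C D : Obj} {f : A ⟶ C} {g : B ⟶ D} {J : Hor A B} {K : Hor C D}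
    (φ : Cell f g J K), vcomp φ (vid K) ≍ φ
  vcomp_assoc : ∀ {A B C D X Y Z W : Obj} {f : A ⟶ C} {g : B ⟶ D} {h : C ⟶ X} {k : D ⟶ Y}
    {p : X ⟶ Z} {q : Y ⟶ W} {J : Hor A B} {K : Hor C D} {L : Hor X Y} {M : Hor Z W}
    (φ : Cell f g J K) (ψ : Cell h k K L) (χ : Cell p q L M),
    vcomp (vcomp φ ψ) χ ≍ vcomp φ (vcomp ψ χ)
  /-- horizontal unit -/
  hunit : ∀ A : Obj, Hor A A
  /-- horizontal unit cell `1_f` of a vertical morphism -/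
  hunitCell : ∀ {A C : Obj} (f : A ⟶ C), Cell f f (hunit A) (hunit C)
  hunitCell_id : ∀ A : Obj, hunitCell (𝟙 A) = vid (hunit A)
  hunitCell_comp : ∀ {A B C : Obj} (f : A ⟶ B) (g : B ⟶ C),
    hunitCell (f ≫ g) = vcomp (hunitCell f) (hunitCell g)
  /-- horizontal composition of horizontal morphisms -/
  hcomp : ∀ {A B C : Obj}, Hor A B → Hor B C → Hor A C
  /-- horizontal composition of cells -/
  hcompCell : ∀ {A B C D X Y : Obj} {f : A ⟶ D} {g : B ⟶ X} {h : C ⟶ Y}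
    {J : Hor A B} {H : Hor B C} {K : Hor D X} {L : Hor X Y},
    Cell f g J K → Cell g h H L → Cell f h (hcomp J H) (hcomp K L)
  hcompCell_vid : ∀ {A B C : Obj} (J : Hor A B) (H : Hor B C),
    hcompCell (vid J) (vid H) = vid (hcomp J H)
  interchange : ∀ {A B C D X Y A' B' C' : Obj} {f : A ⟶ D} {g : B ⟶ X} {h : C ⟶ Y}
    {f' : D ⟶ A'} {g' : X ⟶ B'} {h' : Y ⟶ C'}
    {J : Hor A B} {H : Hor B C} {K : Hor D X} {L : Hor X Y} {M : Hor A' B'} {N : Hor B' C'}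
    (φ : Cell f g J K) (χ : Cell g h H L) (ψ : Cell f' g' K M) (ξ : Cell g' h' L N),
    hcompCell (vcomp φ ψ) (vcomp χ ξ) = vcomp (hcompCell φ χ) (hcompCell ψ ξ)
  /-- associator -/
  assoc : ∀ {A B C D : Obj} (J : Hor A B) (H : Hor B C) (K : Hor C D),
    Cell (𝟙 A) (𝟙 D) (hcomp (hcomp J H) K) (hcomp J (hcomp H K))
  /-- inverse associator -/
  assocInv : ∀ {A B C D : Obj} (J : Hor A B) (H : Hor B C) (K : Hor C D),
    Cell (𝟙 A) (𝟙 D) (hcomp J (hcomp H K)) (hcomp (hcomp J H) K)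
  assoc_assocInv : ∀ {A B C D : Obj} (J : Hor A B) (H : Hor B C) (K : Hor C D),
    vcomp (assoc J H K) (assocInv J H K) ≍ vid (hcomp (hcomp J H) K)
  assocInv_assoc : ∀ {A B C D : Obj} (J : Hor A B) (H : Hor B C) (K : Hor C D),
    vcomp (assocInv J H K) (assoc J H K) ≍ vid (hcomp J (hcomp H K))
  assoc_natural : ∀ {A B C D A' B' C' D' : Obj} {f : A ⟶ A'} {g : B ⟶ B'} {h : C ⟶ C'}
    {k : D ⟶ D'} {J : Hor A B} {H : Hor B C} {K : Hor C D}
    {J' : Hor A' B'} {H' : Hor B' C'} {K' : Hor C' D'}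
    (φ : Cell f g J J') (χ : Cell g h H H') (ψ : Cell h k K K'),
    vcomp (hcompCell (hcompCell φ χ) ψ) (assoc J' H' K') ≍
      vcomp (assoc J H K) (hcompCell φ (hcompCell χ ψ))
  /-- left unitor -/
  lunit : ∀ {A B : Obj} (M : Hor A B), Cell (𝟙 A) (𝟙 B) (hcomp (hunit A) M) M
  /-- inverse left unitor -/
  lunitInv : ∀ {A B : Obj} (M : Hor A B), Cell (𝟙 A) (𝟙 B) M (hcomp (hunit A) M)
  lunit_lunitInv : ∀ {A B : Obj} (M : Hor A B),
    vcomp (lunit M) (lunitInv M) ≍ vid (hcomp (hunit A) M)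
  lunitInv_lunit : ∀ {A B : Obj} (M : Hor A B), vcomp (lunitInv M) (lunit M) ≍ vid M
  lunit_natural : ∀ {A B C D : Obj} {f : A ⟶ C} {g : B ⟶ D} {M : Hor A B} {N : Hor C D}
    (φ : Cell f g M N),
    vcomp (hcompCell (hunitCell f) φ) (lunit N) ≍ vcomp (lunit M) φ
  /-- right unitor -/
  runit : ∀ {A B : Obj} (M : Hor A B), Cell (𝟙 A) (𝟙 B) (hcomp M (hunit B)) M
  /-- inverse right unitor -/
  runitInv : ∀ {A B : Obj} (M : Hor A B), Cell (𝟙 A) (𝟙 B) M (hcomp M (hunit B))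
  runit_runitInv : ∀ {A B : Obj} (M : Hor A B),
    vcomp (runit M) (runitInv M) ≍ vid (hcomp M (hunit B))
  runitInv_runit : ∀ {A B : Obj} (M : Hor A B), vcomp (runitInv M) (runit M) ≍ vid M
  runit_natural : ∀ {A B C D : Obj} {f : A ⟶ C} {g : B ⟶ D} {M : Hor A B} {N : Hor C D}
    (φ : Cell f g M N),
    vcomp (hcompCell φ (hunitCell g)) (runit N) ≍ vcomp (runit M) φ
  pentagon : ∀ {A B C D X : Obj} (J : Hor A B) (H : Hor B C) (K : Hor C D) (L : Hor D X),
    vcomp (vcomp (hcompCell (assoc J H K) (vid L)) (assoc J (hcomp H K) L))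
        (hcompCell (vid J) (assoc H K L)) ≍
      vcomp (assoc (hcomp J H) K L) (assoc J H (hcomp K L))
  triangle : ∀ {A B C : Obj} (J : Hor A B) (H : Hor B C),
    vcomp (assoc J (hunit B) H) (hcompCell (vid J) (lunit H)) ≍
      hcompCell (runit J) (vid H)

namespace DoubleCategory

attribute [instance] DoubleCategory.vert

variable {𝕂 : DoubleCategory.{w₁, w₂, w₃, w₄}}

/-- Two cells with the same horizontal source and target are the same: their vertical sources
agree, their vertical targets agree, and the cells agree. -/
def SameCell {A B C D : 𝕂.Obj} {J : 𝕂.Hor A B} {K : 𝕂.Hor C D}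
    {f f' : A ⟶ C} {g g' : B ⟶ D} (φ : 𝕂.Cell f g J K) (ψ : 𝕂.Cell f' g' J K) : Prop :=
  f = f' ∧ g = g' ∧ φ ≍ ψ

/-- A cell `φ` is opcartesian if any cell whose vertical boundaries factor through those of `φ`,
and whose horizontal source is that of `φ`, factors uniquely through `φ`. -/
def IsOpcartesian {A B C D : 𝕂.Obj} {f : A ⟶ C} {g : B ⟶ D} {J : 𝕂.Hor A B} {K : 𝕂.Hor C D}
    (φ : 𝕂.Cell f g J K) : Prop :=
  ∀ ⦃X Y : 𝕂.Obj⦄ (h : C ⟶ X) (k : D ⟶ Y) (L : 𝕂.Hor X Y) (χ : 𝕂.Cell (f ≫ h) (g ≫ k) J L),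
    ∃! χ' : 𝕂.Cell h k K L, 𝕂.vcomp φ χ' = χ

/-- The horizontal composite, of shape `H ⇒ J`, of a cell `ξ : H ⇒ 1_A` with a cell
`ψ : 1_Y ⇒ J` on its right (unitors inserted). -/
def pasteRight {X Y A B : 𝕂.Obj} {f : X ⟶ A} {g : Y ⟶ A} {k : Y ⟶ B}
    {H : 𝕂.Hor X Y} {J : 𝕂.Hor A B}
    (ξ : 𝕂.Cell f g H (𝕂.hunit A)) (ψ : 𝕂.Cell g k (𝕂.hunit Y) J) :
    𝕂.Cell ((𝟙 X ≫ f) ≫ 𝟙 A) ((𝟙 Y ≫ k) ≫ 𝟙 B) H J :=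
  𝕂.vcomp (𝕂.vcomp (𝕂.runitInv H) (𝕂.hcompCell ξ ψ)) (𝕂.lunit J)

/-- The horizontal composite, of shape `H ⇒ J`, of a cell `φ : 1_X ⇒ J` with a cell
`ξ : H ⇒ 1_B` on its right (unitors inserted). -/
def pasteLeft {X Y A B : 𝕂.Obj} {f : X ⟶ A} {g : X ⟶ B} {k : Y ⟶ B}
    {H : 𝕂.Hor X Y} {J : 𝕂.Hor A B}
    (φ : 𝕂.Cell f g (𝕂.hunit X) J) (ξ : 𝕂.Cell g k H (𝕂.hunit B)) :
    𝕂.Cell ((𝟙 X ≫ f) ≫ 𝟙 A) ((𝟙 Y ≫ k) ≫ 𝟙 B) H J :=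
  𝕂.vcomp (𝕂.vcomp (𝕂.lunitInv H) (𝕂.hcompCell φ ξ)) (𝕂.runit J)

/-- A cell `π : 1_T ⇒ J`, with vertical source `πA` and target `πB`, defines `T` as the
tabulation of `J`. -/
structure IsTabulation {A B T : 𝕂.Obj} {J : 𝕂.Hor A B} {πA : T ⟶ A} {πB : T ⟶ B}
    (π : 𝕂.Cell πA πB (𝕂.hunit T) J) : Prop where
  /-- the 1-dimensional universal property -/
  one_dim : ∀ ⦃X : 𝕂.Obj⦄ ⦃φA : X ⟶ A⦄ ⦃φB : X ⟶ B⦄ (φ : 𝕂.Cell φA φB (𝕂.hunit X) J),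
    ∃! φ' : X ⟶ T, SameCell (𝕂.vcomp (𝕂.hunitCell φ') π) φ
  /-- the 2-dimensional universal property -/
  two_dim : ∀ ⦃X Y : 𝕂.Obj⦄ ⦃φA : X ⟶ A⦄ ⦃φB : X ⟶ B⦄ ⦃ψA : Y ⟶ A⦄ ⦃ψB : Y ⟶ B⦄
    (φ : 𝕂.Cell φA φB (𝕂.hunit X) J) (ψ : 𝕂.Cell ψA ψB (𝕂.hunit Y) J)
    (φ' : X ⟶ T) (ψ' : Y ⟶ T),
    SameCell (𝕂.vcomp (𝕂.hunitCell φ') π) φ → SameCell (𝕂.vcomp (𝕂.hunitCell ψ') π) ψ →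
    ∀ (H : 𝕂.Hor X Y) (ξA : 𝕂.Cell φA ψA H (𝕂.hunit A)) (ξB : 𝕂.Cell φB ψB H (𝕂.hunit B)),
      pasteRight ξA ψ = pasteLeft φ ξB →
      ∃! ξ' : 𝕂.Cell φ' ψ' H (𝕂.hunit T),
        SameCell (𝕂.vcomp ξ' (𝕂.hunitCell πA)) ξA ∧ SameCell (𝕂.vcomp ξ' (𝕂.hunitCell πB)) ξB

/-- A companion of a vertical morphism `f`. -/
structure Companion {A C : 𝕂.Obj} (f : A ⟶ C) where
  /-- the horizontal morphism `f_*` -/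
  hor : 𝕂.Hor A C
  /-- the cell `f_* ⇒ 1_C` -/
  ε : 𝕂.Cell f (𝟙 C) hor (𝕂.hunit C)
  /-- the cell `1_A ⇒ f_*` -/
  η : 𝕂.Cell (𝟙 A) f (𝕂.hunit A) hor
  vert_eq : SameCell (𝕂.vcomp η ε) (𝕂.hunitCell f)
  hor_eq : SameCell (𝕂.vcomp (𝕂.vcomp (𝕂.lunitInv hor) (𝕂.hcompCell η ε)) (𝕂.runit hor))
    (𝕂.vid hor)

/-- A conjoint of a vertical morphism `f`. -/
structure Conjoint {A C : 𝕂.Obj} (f : A ⟶ C) where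
  /-- the horizontal morphism `f^*` -/
  hor : 𝕂.Hor C A
  /-- the cell `f^* ⇒ 1_C` -/
  ε : 𝕂.Cell (𝟙 C) f hor (𝕂.hunit C)
  /-- the cell `1_A ⇒ f^*` -/
  η : 𝕂.Cell f (𝟙 A) (𝕂.hunit A) hor
  vert_eq : SameCell (𝕂.vcomp η ε) (𝕂.hunitCell f)
  hor_eq : SameCell (𝕂.vcomp (𝕂.vcomp (𝕂.runitInv hor) (𝕂.hcompCell ε η)) (𝕂.lunit hor))
    (𝕂.vid hor)

end DoubleCategory

/-- An equipment: a double category with a specified companion and a specified conjoint of each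
vertical morphism. -/
structure Equipment extends DoubleCategory.{w₁, w₂, w₃, w₄} where
  /-- the specified companions -/
  companion : ∀ {A C : Obj} (f : A ⟶ C), DoubleCategory.Companion (𝕂 := toDoubleCategory) f
  /-- the specified conjoints -/
  conjoint : ∀ {A C : Obj} (f : A ⟶ C), DoubleCategory.Conjoint (𝕂 := toDoubleCategory) f

/-- Coequalisers are preserved by pullback: each pullback functor between slices preserves
coequalisers. -/
class CoequalizersPreservedByPullback (E : Type u) [Category.{v} E] [HasPullbacks E] : Prop where
  preserves : ∀ {X Y : E} (f : X ⟶ Y),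
    PreservesColimitsOfShape WalkingParallelPair (Over.pullback f)

namespace InProf

section Descent

variable {E : Type u} [Category.{v} E] [HasPullbacks E] [HasCoequalizers E]
  [CoequalizersPreservedByPullback E]

/-- A coequaliser is one in the slice over its vertex. -/
def overIsColimit {R S Q : E} {s t : R ⟶ S} {q : S ⟶ Q} (w : s ≫ q = t ≫ q)
    (hq : IsColimit (Cofork.ofπ q w)) {s' t' : Over.mk (s ≫ q) ⟶ Over.mk q}
    {q' : Over.mk q ⟶ Over.mk (𝟙 Q)} (hs : s'.left = s) (ht : t'.left = t) (hq' : q'.left = q)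
    (w' : s' ≫ q' = t' ≫ q') : IsColimit (Cofork.ofπ q' w') := by
  have key : ∀ c : Cofork s' t', s ≫ c.π.left = t ≫ c.π.left := fun c => by
    have := congrArg (fun z => z.left) c.condition
    have h1 : s'.left ≫ c.π.left = t'.left ≫ c.π.left := this
    exact ((congrArg (fun z => z ≫ c.π.left) hs.symm).trans h1).trans
      (congrArg (fun z => z ≫ c.π.left) ht)
  have hfac : ∀ c : Cofork s' t', q ≫ (Cofork.IsColimit.desc hq c.π.left (key c)) = c.π.left :=
    fun c => Cofork.IsColimit.π_desc' hq _ (key c)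
  refine Cofork.IsColimit.mk _
    (fun c => Over.homMk (Cofork.IsColimit.desc hq c.π.left (key c)) ?_) ?_ ?_
  · apply Cofork.IsColimit.hom_ext hq
    change q ≫ _ ≫ c.pt.hom = q ≫ 𝟙 Q
    rw [← Category.assoc, hfac c, Category.comp_id]
    exact Over.w c.π
  · intro c
    ext
    change q'.left ≫ _ = _
    rw [hq']
    exact hfac c
  · intro c m hm
    ext
    apply Cofork.IsColimit.hom_ext hq
    have h1 : q'.left ≫ m.left = c.π.left := congrArg (fun z => z.left) hm
    rw [hq'] at h1
    exact h1.trans (hfac c).symm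

/-- The pullback of a coequaliser is a coequaliser. -/
theorem pullback_isColimit {R S Q : E} {s t : R ⟶ S} {q : S ⟶ Q} (w : s ≫ q = t ≫ q)
    (hq : IsColimit (Cofork.ofπ q w)) {X : E} (x : X ⟶ Q) :
    Epi (pullback.snd q x) ∧
    ∀ (Z : E) (k : pullback q x ⟶ Z),
      (∀ (W : E) (w : W ⟶ X) (r : W ⟶ R) (h : (r ≫ s) ≫ q = w ≫ x) (h' : (r ≫ t) ≫ q = w ≫ x),
        pullback.lift (r ≫ s) w h ≫ k = pullback.lift (r ≫ t) w h' ≫ k) →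
      ∃ F : X ⟶ Z, pullback.snd q x ≫ F = k := by
  have := CoequalizersPreservedByPullback.preserves x
  obtain ⟨s', hs⟩ : ∃ s' : Over.mk (s ≫ q) ⟶ Over.mk q, s'.left = s := ⟨Over.homMk s rfl, rfl⟩
  obtain ⟨t', ht⟩ : ∃ s' : Over.mk (s ≫ q) ⟶ Over.mk q, s'.left = t :=
    ⟨Over.homMk t w.symm, rfl⟩
  obtain ⟨q', hq'⟩ : ∃ s' : Over.mk q ⟶ Over.mk (𝟙 Q), s'.left = q :=
    ⟨Over.homMk q (Category.comp_id _), rfl⟩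
  have w' : s' ≫ q' = t' ≫ q' := by
    ext
    change s'.left ≫ q'.left = t'.left ≫ q'.left
    rw [hs, ht, hq', w]
  have h2 := isColimitCoforkMapOfIsColimit (Over.pullback x) w'
    (overIsColimit w hq hs ht hq' w')
  have h3 := isColimitCoforkMapOfIsColimit (Over.forget X)
    (by simp only [← Functor.map_comp, w']) h2
  obtain ⟨m, hm'⟩ : ∃ m : pullback q x ⟶ pullback (𝟙 Q) x,
    m = ((Over.pullback x).map q').left := ⟨_, rfl⟩
  have hm : m ≫ pullback.snd (𝟙 Q) x = pullback.snd q x := by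
    rw [hm']
    exact pullback.lift_snd _ _ _
  have e'e : pullback.lift x (𝟙 X) (by simp) ≫ pullback.snd (𝟙 Q) x = 𝟙 X :=
    pullback.lift_snd _ _ _
  have ee : pullback.snd (𝟙 Q) x ≫ pullback.lift x (𝟙 X) (by simp) = 𝟙 _ := by
    apply pullback.hom_ext
    · rw [Category.assoc, pullback.lift_fst, ← pullback.condition, Category.comp_id,
        Category.id_comp]
    · rw [Category.assoc, pullback.lift_snd, Category.comp_id, Category.id_comp]
  constructor
  · constructor
    intro Z a b hab
    rw [← hm, Category.assoc, Category.assoc] at hab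
    have h4 : pullback.snd (𝟙 Q) x ≫ a = pullback.snd (𝟙 Q) x ≫ b := by
      apply Cofork.IsColimit.hom_ext h3
      rw [hm'] at hab
      exact hab
    have h5 := congrArg (fun z => pullback.lift x (𝟙 X) (by simp) ≫ z) h4
    simp only [← Category.assoc, e'e, Category.id_comp] at h5
    exact h5
  · intro Z k hk
    have hk' : ((Over.pullback x).map s').left ≫ k = ((Over.pullback x).map t').left ≫ k := by
      have h1 : (pullback.fst (s ≫ q) x ≫ s) ≫ q = pullback.snd (s ≫ q) x ≫ x := by
        rw [Category.assoc, pullback.condition]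
      have h2 : (pullback.fst (s ≫ q) x ≫ t) ≫ q = pullback.snd (s ≫ q) x ≫ x := by
        rw [Category.assoc, ← w, pullback.condition]
      have := hk _ (pullback.snd (s ≫ q) x) (pullback.fst (s ≫ q) x) h1 h2
      have e1 : ((Over.pullback x).map s').left =
          pullback.lift (pullback.fst (s ≫ q) x ≫ s) (pullback.snd (s ≫ q) x) h1 := by
        apply pullback.hom_ext
        · refine (pullback.lift_fst _ _ _).trans (Eq.trans ?_ (pullback.lift_fst _ _ _).symm)
          exact congrArg (fun z => pullback.fst (s ≫ q) x ≫ z) hs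
        · exact (pullback.lift_snd _ _ _).trans (pullback.lift_snd _ _ _).symm
      have e2 : ((Over.pullback x).map t').left =
          pullback.lift (pullback.fst (s ≫ q) x ≫ t) (pullback.snd (s ≫ q) x) h2 := by
        apply pullback.hom_ext
        · refine (pullback.lift_fst _ _ _).trans (Eq.trans ?_ (pullback.lift_fst _ _ _).symm)
          exact congrArg (fun z => pullback.fst (s ≫ q) x ≫ z) ht
        · exact (pullback.lift_snd _ _ _).trans (pullback.lift_snd _ _ _).symm
      exact ((congrArg (fun z => z ≫ k) e1).trans this).trans
        (congrArg (fun z => z ≫ k) e2.symm)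
    obtain ⟨F, hF⟩ : ∃ F : pullback (𝟙 Q) x ⟶ Z, ((Over.pullback x).map q').left ≫ F = k := by
      obtain ⟨F, hF⟩ := Cofork.IsColimit.desc' h3 k hk'
      exact ⟨F, hF⟩
    have hF' : m ≫ F = k := by rw [hm']; exact hF
    refine ⟨pullback.lift x (𝟙 X) (by simp) ≫ F, ?_⟩
    rw [← hm, Category.assoc, ← Category.assoc (pullback.snd (𝟙 Q) x), ee, Category.id_comp, hF']

end Descent

section Basic

variable {E : Type u} [Category.{v} E] [HasPullbacks E]

/-- A category internal in `E`. The associativity and unit laws are stated on generalised elements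
`X ⟶ mor`; `pullback.lift a b h ≫ mul` is the composite of `a` followed by `b`. -/
structure InternalCat (E : Type u) [Category.{v} E] [HasPullbacks E] where
  /-- object of objects -/
  obj : E
  /-- object of morphisms -/
  mor : E
  /-- source `d₀` -/
  src : mor ⟶ obj
  /-- target `d₁` -/
  tgt : mor ⟶ obj
  /-- multiplication -/
  mul : pullback tgt src ⟶ mor
  /-- unit -/
  unit : obj ⟶ mor
  mul_src : mul ≫ src = pullback.fst tgt src ≫ src
  mul_tgt : mul ≫ tgt = pullback.snd tgt src ≫ tgt
  unit_src : unit ≫ src = 𝟙 obj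
  unit_tgt : unit ≫ tgt = 𝟙 obj
  unit_mul : ∀ {X : E} (a : X ⟶ mor),
    pullback.lift (a ≫ src ≫ unit) a (by simp [unit_tgt]) ≫ mul = a
  mul_unit : ∀ {X : E} (a : X ⟶ mor),
    pullback.lift a (a ≫ tgt ≫ unit) (by simp [unit_src]) ≫ mul = a
  mul_assoc : ∀ {X : E} (a b c : X ⟶ mor) (h : a ≫ tgt = b ≫ src) (h' : b ≫ tgt = c ≫ src),
    pullback.lift (pullback.lift a b h ≫ mul) c (by simp [mul_tgt, h', pullback.lift_snd_assoc]) ≫ mul =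
      pullback.lift a (pullback.lift b c h' ≫ mul) (by simp [mul_src, h, pullback.lift_fst_assoc]) ≫ mul

/-- An internal functor. -/
@[ext]
structure InternalFunctor (A C : InternalCat E) where
  /-- the map on objects -/
  obj : A.obj ⟶ C.obj
  /-- the map on morphisms -/
  mor : A.mor ⟶ C.mor
  mor_src : mor ≫ C.src = A.src ≫ obj
  mor_tgt : mor ≫ C.tgt = A.tgt ≫ obj
  unit_mor : A.unit ≫ mor = obj ≫ C.unit
  mul_mor : A.mul ≫ mor = pullback.lift (pullback.fst A.tgt A.src ≫ mor)
    (pullback.snd A.tgt A.src ≫ mor)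
    (by simp only [Category.assoc, mor_src, mor_tgt, pullback.condition_assoc]) ≫ C.mul

/-- An internal profunctor from `A` to `B`: a span from `A.obj` to `B.obj` with compatible
actions of `A` and `B`. The laws are stated on generalised elements. -/
structure InternalProf (A B : InternalCat E) where
  /-- the vertex of the span -/
  apex : E
  /-- the left leg `d₀` -/
  left : apex ⟶ A.obj
  /-- the right leg `d₁` -/
  right : apex ⟶ B.obj
  /-- the action of `A` -/
  lact : pullback A.tgt left ⟶ apex
  /-- the action of `B` -/
  ract : pullback right B.src ⟶ apex
  lact_left : lact ≫ left = pullback.fst A.tgt left ≫ A.src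
  lact_right : lact ≫ right = pullback.snd A.tgt left ≫ right
  ract_left : ract ≫ left = pullback.fst right B.src ≫ left
  ract_right : ract ≫ right = pullback.snd right B.src ≫ B.tgt
  unit_lact : ∀ {X : E} (j : X ⟶ apex),
    pullback.lift (j ≫ left ≫ A.unit) j (by simp [A.unit_tgt]) ≫ lact = j
  ract_unit : ∀ {X : E} (j : X ⟶ apex),
    pullback.lift j (j ≫ right ≫ B.unit) (by simp [B.unit_src]) ≫ ract = j
  mul_lact : ∀ {X : E} (a a' : X ⟶ A.mor) (j : X ⟶ apex) (h : a ≫ A.tgt = a' ≫ A.src)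
    (h' : a' ≫ A.tgt = j ≫ left),
    pullback.lift (pullback.lift a a' h ≫ A.mul) j (by simp [A.mul_tgt, h', pullback.lift_snd_assoc]) ≫ lact =
      pullback.lift a (pullback.lift a' j h' ≫ lact) (by simp [lact_left, h, pullback.lift_fst_assoc]) ≫ lact
  ract_mul : ∀ {X : E} (j : X ⟶ apex) (b b' : X ⟶ B.mor) (h : j ≫ right = b ≫ B.src)
    (h' : b ≫ B.tgt = b' ≫ B.src),
    pullback.lift (pullback.lift j b h ≫ ract) b' (by simp [ract_right, h', pullback.lift_snd_assoc]) ≫ ract =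
      pullback.lift j (pullback.lift b b' h' ≫ B.mul) (by simp [B.mul_src, h, pullback.lift_fst_assoc]) ≫ ract
  lact_ract : ∀ {X : E} (a : X ⟶ A.mor) (j : X ⟶ apex) (b : X ⟶ B.mor)
    (h : a ≫ A.tgt = j ≫ left) (h' : j ≫ right = b ≫ B.src),
    pullback.lift (pullback.lift a j h ≫ lact) b (by simp [lact_right, h', pullback.lift_snd_assoc]) ≫ ract =
      pullback.lift a (pullback.lift j b h' ≫ ract) (by simp [ract_left, h, pullback.lift_fst_assoc]) ≫ lact

/-- A transformation of internal profunctors: a map of spans compatible with the actions. -/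
@[ext]
structure InternalTrans {A B C D : InternalCat E} (f : InternalFunctor A C)
    (g : InternalFunctor B D) (J : InternalProf A B) (K : InternalProf C D) where
  /-- the underlying map -/
  hom : J.apex ⟶ K.apex
  hom_left : hom ≫ K.left = J.left ≫ f.obj
  hom_right : hom ≫ K.right = J.right ≫ g.obj
  lact_hom : J.lact ≫ hom = pullback.lift (pullback.fst A.tgt J.left ≫ f.mor)
    (pullback.snd A.tgt J.left ≫ hom)
    (by simp only [Category.assoc, f.mor_tgt, hom_left, pullback.condition_assoc]) ≫ K.lact
  ract_hom : J.ract ≫ hom = pullback.lift (pullback.fst J.right B.src ≫ hom)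
    (pullback.snd J.right B.src ≫ g.mor)
    (by simp only [Category.assoc, g.mor_src, hom_right, pullback.condition_assoc]) ≫ K.ract

attribute [local simp] pullback.lift_fst pullback.lift_fst_assoc pullback.lift_snd
  pullback.lift_snd_assoc

theorem comp_lift {X W P Q R : E} {f : P ⟶ R} {g : Q ⟶ R} (w : W ⟶ X) (a : X ⟶ P) (b : X ⟶ Q)
    (h : a ≫ f = b ≫ g) : w ≫ pullback.lift a b h =
      pullback.lift (w ≫ a) (w ≫ b) (by simp only [Category.assoc, h]) := by
  apply pullback.hom_ext <;> simp

theorem lift_eta {X P Q R : E} {f : P ⟶ R} {g : Q ⟶ R} (x : X ⟶ pullback f g) :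
    pullback.lift (x ≫ pullback.fst f g) (x ≫ pullback.snd f g)
      (by simp only [Category.assoc, pullback.condition]) = x := by
  apply pullback.hom_ext <;> simp

attribute [simp] InternalCat.unit_src InternalCat.unit_tgt InternalFunctor.mor_src
  InternalFunctor.mor_tgt InternalFunctor.unit_mor InternalTrans.hom_left InternalTrans.hom_right

namespace InternalCat

variable (A : InternalCat E)

@[simp] theorem unit_src_assoc {Z : E} (z : A.obj ⟶ Z) : A.unit ≫ A.src ≫ z = z := by
  simp [← Category.assoc]

@[simp] theorem unit_tgt_assoc {Z : E} (z : A.obj ⟶ Z) : A.unit ≫ A.tgt ≫ z = z := by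
  simp [← Category.assoc]

/-- The composite of the generalised morphisms `a` and `b`, in diagrammatic order. -/
def comp {X : E} (a b : X ⟶ A.mor) (h : a ≫ A.tgt = b ≫ A.src) : X ⟶ A.mor :=
  pullback.lift a b h ≫ A.mul

variable {A} {X W : E}

@[simp] theorem comp_comp (w : W ⟶ X) (a b : X ⟶ A.mor) (h : a ≫ A.tgt = b ≫ A.src) :
    w ≫ A.comp a b h = A.comp (w ≫ a) (w ≫ b) (by simp only [Category.assoc, h]) := by
  simp only [comp, ← Category.assoc, comp_lift]

@[simp] theorem comp_comp_assoc {Z : E} (w : W ⟶ X) (a b : X ⟶ A.mor)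
    (h : a ≫ A.tgt = b ≫ A.src) (z : A.mor ⟶ Z) : w ≫ A.comp a b h ≫ z =
      A.comp (w ≫ a) (w ≫ b) (by simp only [Category.assoc, h]) ≫ z := by
  rw [← Category.assoc, comp_comp]

@[simp] theorem comp_src (a b : X ⟶ A.mor) (h : a ≫ A.tgt = b ≫ A.src) :
    A.comp a b h ≫ A.src = a ≫ A.src := by
  simp [comp, A.mul_src]

@[simp] theorem comp_tgt (a b : X ⟶ A.mor) (h : a ≫ A.tgt = b ≫ A.src) :
    A.comp a b h ≫ A.tgt = b ≫ A.tgt := by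
  simp [comp, A.mul_tgt]

@[simp] theorem comp_src_assoc {Z : E} (a b : X ⟶ A.mor) (h : a ≫ A.tgt = b ≫ A.src)
    (z : A.obj ⟶ Z) : A.comp a b h ≫ A.src ≫ z = a ≫ A.src ≫ z := by
  rw [← Category.assoc, comp_src, Category.assoc]

@[simp] theorem comp_tgt_assoc {Z : E} (a b : X ⟶ A.mor) (h : a ≫ A.tgt = b ≫ A.src)
    (z : A.obj ⟶ Z) : A.comp a b h ≫ A.tgt ≫ z = b ≫ A.tgt ≫ z := by
  rw [← Category.assoc, comp_tgt, Category.assoc]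

end InternalCat

namespace InternalFunctor

variable {A C D : InternalCat E} {X : E}

@[simp] theorem mor_src_assoc (f : InternalFunctor A C) {Z : E} (z : C.obj ⟶ Z) :
    f.mor ≫ C.src ≫ z = A.src ≫ f.obj ≫ z := by
  rw [← Category.assoc, f.mor_src, Category.assoc]

@[simp] theorem mor_tgt_assoc (f : InternalFunctor A C) {Z : E} (z : C.obj ⟶ Z) :
    f.mor ≫ C.tgt ≫ z = A.tgt ≫ f.obj ≫ z := by
  rw [← Category.assoc, f.mor_tgt, Category.assoc]

@[simp] theorem unit_mor_assoc (f : InternalFunctor A C) {Z : E} (z : C.mor ⟶ Z) :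
    A.unit ≫ f.mor ≫ z = f.obj ≫ C.unit ≫ z := by
  rw [← Category.assoc, f.unit_mor, Category.assoc]

@[simp] theorem comp_mor (f : InternalFunctor A C) (a b : X ⟶ A.mor)
    (h : a ≫ A.tgt = b ≫ A.src) : A.comp a b h ≫ f.mor =
      C.comp (a ≫ f.mor) (b ≫ f.mor) (by simp [reassoc_of% h]) := by
  rw [InternalCat.comp, Category.assoc, f.mul_mor, ← Category.assoc, comp_lift]
  simp [InternalCat.comp]

@[simp] theorem comp_mor_assoc (f : InternalFunctor A C) (a b : X ⟶ A.mor)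
    (h : a ≫ A.tgt = b ≫ A.src) {Z : E} (z : C.mor ⟶ Z) : A.comp a b h ≫ f.mor ≫ z =
      C.comp (a ≫ f.mor) (b ≫ f.mor) (by simp [reassoc_of% h]) ≫ z := by
  rw [← Category.assoc, f.comp_mor]

/-- The compatibility with multiplication of an internal functor, from its form on generalised
elements. -/
theorem mul_mor_of_comp {A C : InternalCat E} {m : A.mor ⟶ C.mor}
    (h : (pullback.fst A.tgt A.src ≫ m) ≫ C.tgt = (pullback.snd A.tgt A.src ≫ m) ≫ C.src)
    (hm : A.comp (pullback.fst A.tgt A.src) (pullback.snd A.tgt A.src) pullback.condition ≫ m =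
      C.comp _ _ h) :
    A.mul ≫ m = pullback.lift (pullback.fst A.tgt A.src ≫ m) (pullback.snd A.tgt A.src ≫ m) h
      ≫ C.mul := by
  simpa [InternalCat.comp] using hm

end InternalFunctor

namespace InternalProf

variable {A B : InternalCat E} (J : InternalProf A B) {X W : E}

/-- The action of `A` on generalised elements. -/
def la (a : X ⟶ A.mor) (j : X ⟶ J.apex) (h : a ≫ A.tgt = j ≫ J.left) : X ⟶ J.apex :=
  pullback.lift a j h ≫ J.lact

/-- The action of `B` on generalised elements. -/
def ra (j : X ⟶ J.apex) (b : X ⟶ B.mor) (h : j ≫ J.right = b ≫ B.src) : X ⟶ J.apex :=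
  pullback.lift j b h ≫ J.ract

variable {J}

@[simp] theorem comp_la (w : W ⟶ X) (a : X ⟶ A.mor) (j : X ⟶ J.apex)
    (h : a ≫ A.tgt = j ≫ J.left) :
    w ≫ J.la a j h = J.la (w ≫ a) (w ≫ j) (by simp only [Category.assoc, h]) := by
  simp only [la, ← Category.assoc, comp_lift]

@[simp] theorem comp_ra (w : W ⟶ X) (j : X ⟶ J.apex) (b : X ⟶ B.mor)
    (h : j ≫ J.right = b ≫ B.src) :
    w ≫ J.ra j b h = J.ra (w ≫ j) (w ≫ b) (by simp only [Category.assoc, h]) := by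
  simp only [ra, ← Category.assoc, comp_lift]

@[simp] theorem comp_la_assoc {Z : E} (w : W ⟶ X) (a : X ⟶ A.mor) (j : X ⟶ J.apex)
    (h : a ≫ A.tgt = j ≫ J.left) (z : J.apex ⟶ Z) :
    w ≫ J.la a j h ≫ z = J.la (w ≫ a) (w ≫ j) (by simp only [Category.assoc, h]) ≫ z := by
  rw [← Category.assoc, comp_la]

@[simp] theorem comp_ra_assoc {Z : E} (w : W ⟶ X) (j : X ⟶ J.apex) (b : X ⟶ B.mor)
    (h : j ≫ J.right = b ≫ B.src) (z : J.apex ⟶ Z) :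
    w ≫ J.ra j b h ≫ z = J.ra (w ≫ j) (w ≫ b) (by simp only [Category.assoc, h]) ≫ z := by
  rw [← Category.assoc, comp_ra]

@[simp] theorem la_left (a : X ⟶ A.mor) (j : X ⟶ J.apex) (h : a ≫ A.tgt = j ≫ J.left) :
    J.la a j h ≫ J.left = a ≫ A.src := by
  simp [la, J.lact_left]

@[simp] theorem la_right (a : X ⟶ A.mor) (j : X ⟶ J.apex) (h : a ≫ A.tgt = j ≫ J.left) :
    J.la a j h ≫ J.right = j ≫ J.right := by
  simp [la, J.lact_right]

@[simp] theorem ra_left (j : X ⟶ J.apex) (b : X ⟶ B.mor) (h : j ≫ J.right = b ≫ B.src) :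
    J.ra j b h ≫ J.left = j ≫ J.left := by
  simp [ra, J.ract_left]

@[simp] theorem ra_right (j : X ⟶ J.apex) (b : X ⟶ B.mor) (h : j ≫ J.right = b ≫ B.src) :
    J.ra j b h ≫ J.right = b ≫ B.tgt := by
  simp [ra, J.ract_right]

@[simp] theorem la_left_assoc {Z : E} (a : X ⟶ A.mor) (j : X ⟶ J.apex)
    (h : a ≫ A.tgt = j ≫ J.left) (z : A.obj ⟶ Z) :
    J.la a j h ≫ J.left ≫ z = a ≫ A.src ≫ z := by
  rw [← Category.assoc, la_left, Category.assoc]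

@[simp] theorem la_right_assoc {Z : E} (a : X ⟶ A.mor) (j : X ⟶ J.apex)
    (h : a ≫ A.tgt = j ≫ J.left) (z : B.obj ⟶ Z) :
    J.la a j h ≫ J.right ≫ z = j ≫ J.right ≫ z := by
  rw [← Category.assoc, la_right, Category.assoc]

@[simp] theorem ra_left_assoc {Z : E} (j : X ⟶ J.apex) (b : X ⟶ B.mor)
    (h : j ≫ J.right = b ≫ B.src) (z : A.obj ⟶ Z) :
    J.ra j b h ≫ J.left ≫ z = j ≫ J.left ≫ z := by
  rw [← Category.assoc, ra_left, Category.assoc]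

@[simp] theorem ra_right_assoc {Z : E} (j : X ⟶ J.apex) (b : X ⟶ B.mor)
    (h : j ≫ J.right = b ≫ B.src) (z : B.obj ⟶ Z) :
    J.ra j b h ≫ J.right ≫ z = b ≫ B.tgt ≫ z := by
  rw [← Category.assoc, ra_right, Category.assoc]

theorem la_unit (a : X ⟶ A.obj) (j : X ⟶ J.apex) (h : (a ≫ A.unit) ≫ A.tgt = j ≫ J.left) :
    J.la (a ≫ A.unit) j h = j := by
  obtain rfl : a = j ≫ J.left := by simpa using h
  simpa [la] using J.unit_lact j

theorem ra_unit (j : X ⟶ J.apex) (b : X ⟶ B.obj) (h : j ≫ J.right = (b ≫ B.unit) ≫ B.src) :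
    J.ra j (b ≫ B.unit) h = j := by
  obtain rfl : b = j ≫ J.right := by simpa using h.symm
  simpa [ra] using J.ract_unit j

theorem la_comp (a a' : X ⟶ A.mor) (j : X ⟶ J.apex) (h : a ≫ A.tgt = a' ≫ A.src)
    (h' : A.comp a a' h ≫ A.tgt = j ≫ J.left) :
    J.la (A.comp a a' h) j h' =
      J.la a (J.la a' j (by simpa using h')) (by simpa using h) :=
  J.mul_lact a a' j h (by simpa using h')

theorem ra_ra (j : X ⟶ J.apex) (b b' : X ⟶ B.mor) (h : j ≫ J.right = b ≫ B.src)
    (h' : J.ra j b h ≫ J.right = b' ≫ B.src) :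
    J.ra (J.ra j b h) b' h' =
      J.ra j (B.comp b b' (by simpa using h')) (by simpa using h) :=
  J.ract_mul j b b' h (by simpa using h')

theorem ra_la (a : X ⟶ A.mor) (j : X ⟶ J.apex) (b : X ⟶ B.mor) (h : a ≫ A.tgt = j ≫ J.left)
    (h' : J.la a j h ≫ J.right = b ≫ B.src) :
    J.ra (J.la a j h) b h' =
      J.la a (J.ra j b (by simpa using h')) (by simpa using h) :=
  J.lact_ract a j b h (by simpa using h')

end InternalProf

namespace InternalTrans

variable {A B C D : InternalCat E} {f : InternalFunctor A C} {g : InternalFunctor B D}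
  {J : InternalProf A B} {K : InternalProf C D} (φ : InternalTrans f g J K) {X : E}

@[simp] theorem hom_left_assoc {Z : E} (z : C.obj ⟶ Z) :
    φ.hom ≫ K.left ≫ z = J.left ≫ f.obj ≫ z := by
  rw [← Category.assoc, φ.hom_left, Category.assoc]

@[simp] theorem hom_right_assoc {Z : E} (z : D.obj ⟶ Z) :
    φ.hom ≫ K.right ≫ z = J.right ≫ g.obj ≫ z := by
  rw [← Category.assoc, φ.hom_right, Category.assoc]

@[simp] theorem la_hom (a : X ⟶ A.mor) (j : X ⟶ J.apex) (h : a ≫ A.tgt = j ≫ J.left) :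
    J.la a j h ≫ φ.hom = K.la (a ≫ f.mor) (j ≫ φ.hom) (by simp [reassoc_of% h]) := by
  rw [InternalProf.la, Category.assoc, φ.lact_hom, ← Category.assoc, comp_lift]
  simp [InternalProf.la]

@[simp] theorem ra_hom (j : X ⟶ J.apex) (b : X ⟶ B.mor) (h : j ≫ J.right = b ≫ B.src) :
    J.ra j b h ≫ φ.hom = K.ra (j ≫ φ.hom) (b ≫ g.mor) (by simp [reassoc_of% h]) := by
  rw [InternalProf.ra, Category.assoc, φ.ract_hom, ← Category.assoc, comp_lift]
  simp [InternalProf.ra]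

@[simp] theorem la_hom_assoc (a : X ⟶ A.mor) (j : X ⟶ J.apex) (h : a ≫ A.tgt = j ≫ J.left)
    {Z : E} (z : K.apex ⟶ Z) : J.la a j h ≫ φ.hom ≫ z =
      K.la (a ≫ f.mor) (j ≫ φ.hom) (by simp [reassoc_of% h]) ≫ z := by
  rw [← Category.assoc, φ.la_hom]

@[simp] theorem ra_hom_assoc (j : X ⟶ J.apex) (b : X ⟶ B.mor) (h : j ≫ J.right = b ≫ B.src)
    {Z : E} (z : K.apex ⟶ Z) : J.ra j b h ≫ φ.hom ≫ z =
      K.ra (j ≫ φ.hom) (b ≫ g.mor) (by simp [reassoc_of% h]) ≫ z := by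
  rw [← Category.assoc, φ.ra_hom]

/-- A transformation, from its compatibility with the actions on generalised elements. -/
def mk' (hom : J.apex ⟶ K.apex) (hl : hom ≫ K.left = J.left ≫ f.obj)
    (hr : hom ≫ K.right = J.right ≫ g.obj)
    (hla : ∀ {X : E} (a : X ⟶ A.mor) (j : X ⟶ J.apex) (h : a ≫ A.tgt = j ≫ J.left),
      J.la a j h ≫ hom = K.la (a ≫ f.mor) (j ≫ hom) (by simp [hl, reassoc_of% h]))
    (hra : ∀ {X : E} (j : X ⟶ J.apex) (b : X ⟶ B.mor) (h : j ≫ J.right = b ≫ B.src),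
      J.ra j b h ≫ hom = K.ra (j ≫ hom) (b ≫ g.mor) (by simp [hr, reassoc_of% h])) :
    InternalTrans f g J K where
  hom := hom
  hom_left := hl
  hom_right := hr
  lact_hom := by
    simpa [InternalProf.la] using hla (pullback.fst A.tgt J.left) (pullback.snd A.tgt J.left)
      pullback.condition
  ract_hom := by
    simpa [InternalProf.ra] using hra (pullback.fst J.right B.src) (pullback.snd J.right B.src)
      pullback.condition

theorem heq_of_hom {f' : InternalFunctor A C} {g' : InternalFunctor B D}
    (φ : InternalTrans f g J K) (ψ : InternalTrans f' g' J K) (hf : f = f') (hg : g = g')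
    (h : φ.hom = ψ.hom) : φ ≍ ψ := by
  subst hf hg
  exact heq_of_eq (InternalTrans.ext h)

end InternalTrans

end Basic

section Tensor

variable {E : Type u} [Category.{v} E] [HasPullbacks E]

attribute [local simp] pullback.lift_fst pullback.lift_fst_assoc pullback.lift_snd
  pullback.lift_snd_assoc

namespace InternalProf

variable {A B C : InternalCat E} (J : InternalProf A B) (H : InternalProf B C)

/-- The triple pullback `J ×_{B₀} B ×_{B₀} H`. -/
abbrev triple : E := pullback (pullback.snd J.right B.src ≫ B.tgt) H.left

/-- The map `J ×_{B₀} B ×_{B₀} H ⟶ J ×_{B₀} H` given by the action of `B` on `J`. -/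
def actL : triple J H ⟶ pullback J.right H.left :=
  pullback.lift (pullback.fst _ _ ≫ J.ract) (pullback.snd _ _)
    (by rw [Category.assoc, J.ract_right, pullback.condition])

/-- The map `J ×_{B₀} B ×_{B₀} H ⟶ J ×_{B₀} H` given by the action of `B` on `H`. -/
def actR : triple J H ⟶ pullback J.right H.left :=
  pullback.lift (pullback.fst _ _ ≫ pullback.fst _ _)
    (pullback.lift (pullback.fst _ _ ≫ pullback.snd _ _) (pullback.snd _ _)
      (by rw [Category.assoc, pullback.condition]) ≫ H.lact)
    (by simp [H.lact_left, pullback.condition])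

variable {J H} {X W : E}

/-- The element of the triple pullback given by its components. -/
def tripleMk (j : X ⟶ J.apex) (b : X ⟶ B.mor) (h : X ⟶ H.apex) (jb : j ≫ J.right = b ≫ B.src)
    (bh : b ≫ B.tgt = h ≫ H.left) : X ⟶ triple J H :=
  pullback.lift (pullback.lift j b jb) h (by simp [bh])

theorem tripleMk_actL (j : X ⟶ J.apex) (b : X ⟶ B.mor) (h : X ⟶ H.apex)
    (jb : j ≫ J.right = b ≫ B.src) (bh : b ≫ B.tgt = h ≫ H.left) :
    tripleMk j b h jb bh ≫ actL J H = pullback.lift (J.ra j b jb) h (by simp [bh]) := by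
  apply pullback.hom_ext <;> simp [tripleMk, actL, ra]

theorem tripleMk_actR (j : X ⟶ J.apex) (b : X ⟶ B.mor) (h : X ⟶ H.apex)
    (jb : j ≫ J.right = b ≫ B.src) (bh : b ≫ B.tgt = h ≫ H.left) :
    tripleMk j b h jb bh ≫ actR J H = pullback.lift j (H.la b h bh) (by simp [jb]) := by
  apply pullback.hom_ext
  · simp [tripleMk, actR]
  · rw [actR, Category.assoc, pullback.lift_snd, pullback.lift_snd, ← Category.assoc, comp_lift]
    simp [tripleMk, la]

theorem tripleMk_eta (r : X ⟶ triple J H) :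
    ∃ j b h jb bh, r = tripleMk j b h jb bh := by
  refine ⟨r ≫ pullback.fst _ _ ≫ pullback.fst _ _, r ≫ pullback.fst _ _ ≫ pullback.snd _ _,
    r ≫ pullback.snd _ _, ?_, ?_, ?_⟩
  · simp [pullback.condition]
  · simp only [Category.assoc, pullback.condition]
  · apply pullback.hom_ext
    · apply pullback.hom_ext <;> simp [tripleMk]
    · simp [tripleMk]

variable [HasCoequalizers E] (J H)

/-- The vertex of the composite profunctor: the coequaliser of
`J ×_{B₀} B ×_{B₀} H ⇉ J ×_{B₀} H`. -/
def hobj : E := coequalizer (actL J H) (actR J H)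

/-- The coequaliser projection. -/
def hproj : pullback J.right H.left ⟶ hobj J H := coequalizer.π (actL J H) (actR J H)

theorem hproj_condition : actL J H ≫ hproj J H = actR J H ≫ hproj J H :=
  coequalizer.condition _ _

/-- The coequaliser projection is a coequaliser. -/
def hprojIsColimit : IsColimit (Cofork.ofπ (hproj J H) (hproj_condition J H)) :=
  coequalizerIsCoequalizer _ _

variable {J H}

/-- The element of the composite given by a compatible pair of elements. -/
def tens₀ (j : X ⟶ J.apex) (h : X ⟶ H.apex) (jh : j ≫ J.right = h ≫ H.left) : X ⟶ hobj J H :=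
  pullback.lift j h jh ≫ hproj J H

theorem comp_tens₀ (w : W ⟶ X) (j : X ⟶ J.apex) (h : X ⟶ H.apex)
    (jh : j ≫ J.right = h ≫ H.left) : w ≫ tens₀ j h jh =
      tens₀ (w ≫ j) (w ≫ h) (by simp only [Category.assoc, jh]) := by
  simp only [tens₀, ← Category.assoc, comp_lift]

theorem tens₀_bal (j : X ⟶ J.apex) (b : X ⟶ B.mor) (h : X ⟶ H.apex)
    (jb : j ≫ J.right = b ≫ B.src) (bh : b ≫ B.tgt = h ≫ H.left) :
    tens₀ (J.ra j b jb) h (by simp [bh]) = tens₀ j (H.la b h bh) (by simp [jb]) := by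
  simp only [tens₀]
  rw [← tripleMk_actL j b h jb bh, ← tripleMk_actR j b h jb bh, Category.assoc, Category.assoc,
    hproj_condition]

/-- Maps out of the composite, from balanced families on pairs of elements. -/
theorem exists_desc₀ {Z : E}
    (K : ∀ {W : E} (j : W ⟶ J.apex) (h : W ⟶ H.apex) (_ : j ≫ J.right = h ≫ H.left), W ⟶ Z)
    (nat : ∀ {V W : E} (p : V ⟶ W) (j : W ⟶ J.apex) (h : W ⟶ H.apex)
      (e : j ≫ J.right = h ≫ H.left) (e' : (p ≫ j) ≫ J.right = (p ≫ h) ≫ H.left),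
      p ≫ K j h e = K (p ≫ j) (p ≫ h) e')
    (bal : ∀ {W : E} (j : W ⟶ J.apex) (b : W ⟶ B.mor) (h : W ⟶ H.apex)
      (jb : j ≫ J.right = b ≫ B.src) (bh : b ≫ B.tgt = h ≫ H.left)
      (e : J.ra j b jb ≫ J.right = h ≫ H.left) (e' : j ≫ J.right = H.la b h bh ≫ H.left),
      K (J.ra j b jb) h e = K j (H.la b h bh) e') :
    ∃ F : hobj J H ⟶ Z, ∀ {W : E} (j : W ⟶ J.apex) (h : W ⟶ H.apex)
      (e : j ≫ J.right = h ≫ H.left), tens₀ j h e ≫ F = K j h e := by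
  have key : actL J H ≫ K (pullback.fst _ _) (pullback.snd _ _) pullback.condition =
      actR J H ≫ K (pullback.fst _ _) (pullback.snd _ _) pullback.condition := by
    obtain ⟨j, b, h, jb, bh, hr⟩ := tripleMk_eta (𝟙 (triple J H))
    rw [← Category.id_comp (actL J H), ← Category.id_comp (actR J H), hr, tripleMk_actL,
      tripleMk_actR, nat _ _ _ _ (by simp [bh]), nat _ _ _ _ (by simp [jb])]
    simp only [pullback.lift_fst, pullback.lift_snd]
    exact bal _ _ _ _ _ _ _
  refine ⟨Cofork.IsColimit.desc (hprojIsColimit J H) _ key, ?_⟩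
  intro W j h e
  have hd : hproj J H ≫ Cofork.IsColimit.desc (hprojIsColimit J H) _ key = _ :=
    Cofork.IsColimit.π_desc' (hprojIsColimit J H) _ key
  rw [tens₀, Category.assoc, hd, nat _ _ _ _ (by simp [e])]
  simp only [pullback.lift_fst, pullback.lift_snd]

section Stable

variable [CoequalizersPreservedByPullback E]

/-- Any element of the composite is locally given by a pair of elements. -/
theorem exists_cover₀ (x : X ⟶ hobj J H) :
    ∃ (W : E) (p : W ⟶ X) (j : W ⟶ J.apex) (h : W ⟶ H.apex) (e : j ≫ J.right = h ≫ H.left),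
      Epi p ∧ p ≫ x = tens₀ j h e := by
  refine ⟨pullback (hproj J H) x, pullback.snd _ _, pullback.fst _ _ ≫ pullback.fst _ _,
    pullback.fst _ _ ≫ pullback.snd _ _, by simp only [Category.assoc, pullback.condition],
    (pullback_isColimit _ (hprojIsColimit J H) x).1, ?_⟩
  rw [tens₀, lift_eta, pullback.condition]

/-- Maps out of an object over the composite, from balanced families. -/
theorem exists_descOver₀ {Z : E} (x : X ⟶ hobj J H)
    (K : ∀ {W : E} (w : W ⟶ X) (j : W ⟶ J.apex) (h : W ⟶ H.apex)
      (e : j ≫ J.right = h ≫ H.left) (_ : w ≫ x = tens₀ j h e), W ⟶ Z)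
    (nat : ∀ {V W : E} (p : V ⟶ W) (w : W ⟶ X) (j : W ⟶ J.apex) (h : W ⟶ H.apex)
      (e : j ≫ J.right = h ≫ H.left) (q : w ≫ x = tens₀ j h e)
      (e' : (p ≫ j) ≫ J.right = (p ≫ h) ≫ H.left) (q' : (p ≫ w) ≫ x = tens₀ _ _ e'),
      p ≫ K w j h e q = K (p ≫ w) (p ≫ j) (p ≫ h) e' q')
    (bal : ∀ {W : E} (w : W ⟶ X) (j : W ⟶ J.apex) (b : W ⟶ B.mor) (h : W ⟶ H.apex)
      (jb : j ≫ J.right = b ≫ B.src) (bh : b ≫ B.tgt = h ≫ H.left)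
      (e : J.ra j b jb ≫ J.right = h ≫ H.left) (e' : j ≫ J.right = H.la b h bh ≫ H.left)
      (q : w ≫ x = tens₀ _ _ e) (q' : w ≫ x = tens₀ _ _ e'),
      K w (J.ra j b jb) h e q = K w j (H.la b h bh) e' q') :
    ∃ F : X ⟶ Z, ∀ {W : E} (w : W ⟶ X) (j : W ⟶ J.apex) (h : W ⟶ H.apex)
      (e : j ≫ J.right = h ≫ H.left) (q : w ≫ x = tens₀ j h e), w ≫ F = K w j h e q := by
  have hq : pullback.snd (hproj J H) x ≫ x =
      tens₀ (pullback.fst (hproj J H) x ≫ pullback.fst _ _)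
        (pullback.fst (hproj J H) x ≫ pullback.snd _ _)
        (by simp only [Category.assoc, pullback.condition]) := by
    rw [tens₀, lift_eta, pullback.condition]
  obtain ⟨F, hF⟩ := (pullback_isColimit _ (hprojIsColimit J H) x).2 Z
    (K (pullback.snd _ _) (pullback.fst _ _ ≫ pullback.fst _ _)
      (pullback.fst _ _ ≫ pullback.snd _ _) (by simp only [Category.assoc, pullback.condition])
      hq) (by
      intro W w r h h'
      obtain ⟨j, b, k, jb, bh, rfl⟩ := tripleMk_eta r
      rw [tripleMk_actL] at h
      rw [tripleMk_actR] at h'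
      rw [nat _ _ _ _ _ _ (by simp [tripleMk_actL, bh])
          (by rw [Category.assoc, hq, comp_tens₀]),
        nat _ _ _ _ _ _ (by simp [tripleMk_actR, jb])
          (by rw [Category.assoc, hq, comp_tens₀])]
      simp only [pullback.lift_fst, pullback.lift_snd, pullback.lift_fst_assoc, tripleMk_actL,
        tripleMk_actR]
      exact bal w j b k jb bh _ _ h.symm h'.symm)
  refine ⟨F, ?_⟩
  intro W w j h e q
  have q₀ : pullback.lift j h e ≫ hproj J H = w ≫ x := q.symm
  have : w = pullback.lift (pullback.lift j h e) w q₀ ≫ pullback.snd (hproj J H) x := by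
    simp
  conv_lhs => rw [this]
  rw [Category.assoc, hF, nat _ _ _ _ _ _ (by simp only [Category.assoc, pullback.condition])
    (by rw [Category.assoc, hq, comp_tens₀])]
  simp

end Stable

end InternalProf

end Tensor

section Composite

variable {E : Type u} [Category.{v} E] [HasPullbacks E] [HasCoequalizers E]

attribute [local simp] pullback.lift_fst pullback.lift_fst_assoc pullback.lift_snd
  pullback.lift_snd_assoc

namespace InternalProf

variable {A B C : InternalCat E} (J : InternalProf A B) (H : InternalProf B C) {X W : E}

theorem exists_hleft : ∃ F : hobj J H ⟶ A.obj, ∀ {W : E} (j : W ⟶ J.apex) (h : W ⟶ H.apex)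
    (e : j ≫ J.right = h ≫ H.left), tens₀ j h e ≫ F = j ≫ J.left :=
  exists_desc₀ (fun j _ _ => j ≫ J.left) (by intros; simp) (by intros; simp)

theorem exists_hright : ∃ F : hobj J H ⟶ C.obj, ∀ {W : E} (j : W ⟶ J.apex) (h : W ⟶ H.apex)
    (e : j ≫ J.right = h ≫ H.left), tens₀ j h e ≫ F = h ≫ H.right :=
  exists_desc₀ (fun _ h _ => h ≫ H.right) (by intros; simp) (by intros; simp)

/-- The left leg of the composite: `j ⊗ h ↦ d₀ j`. -/
def hleft : hobj J H ⟶ A.obj := (exists_hleft J H).choose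

/-- The right leg of the composite: `j ⊗ h ↦ d₁ h`. -/
def hright : hobj J H ⟶ C.obj := (exists_hright J H).choose

variable {J H}

theorem tens₀_left (j : X ⟶ J.apex) (h : X ⟶ H.apex) (e : j ≫ J.right = h ≫ H.left) :
    tens₀ j h e ≫ hleft J H = j ≫ J.left :=
  (exists_hleft J H).choose_spec j h e

theorem tens₀_right (j : X ⟶ J.apex) (h : X ⟶ H.apex) (e : j ≫ J.right = h ≫ H.left) :
    tens₀ j h e ≫ hright J H = h ≫ H.right :=
  (exists_hright J H).choose_spec j h e

variable (J H) [CoequalizersPreservedByPullback E]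

theorem exists_hlact : ∃ F : pullback A.tgt (hleft J H) ⟶ hobj J H,
    ∀ {W : E} (a : W ⟶ A.mor) (j : W ⟶ J.apex) (h : W ⟶ H.apex) (e : j ≫ J.right = h ≫ H.left)
      (q : a ≫ A.tgt = j ≫ J.left), pullback.lift a (tens₀ j h e) (by rw [q, tens₀_left]) ≫ F =
        tens₀ (J.la a j q) h (by simpa using e) := by
  have key : ∀ {W : E} (w : W ⟶ pullback A.tgt (hleft J H)) (j : W ⟶ J.apex) (h : W ⟶ H.apex)
      (e : j ≫ J.right = h ≫ H.left) (_ : w ≫ pullback.snd _ _ = tens₀ j h e),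
      (w ≫ pullback.fst _ _) ≫ A.tgt = j ≫ J.left := by
    intro W w j h e q
    rw [Category.assoc, pullback.condition, ← Category.assoc, q, tens₀_left]
  obtain ⟨F, hF⟩ := exists_descOver₀ (pullback.snd A.tgt (hleft J H))
    (fun w j h e q => tens₀ (J.la (w ≫ pullback.fst _ _) j (key w j h e q)) h (by simpa using e))
    (by intros; simp [comp_tens₀])
    (by
      intro W w j b h jb bh e e' q q'
      rw [← tens₀_bal _ _ _ (by simpa using jb)]
      congr 1
      rw [ra_la])
  refine ⟨F, ?_⟩
  intro W a j h e q
  rw [hF _ j h e (by simp)]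
  simp

theorem exists_hract : ∃ F : pullback (hright J H) C.src ⟶ hobj J H,
    ∀ {W : E} (j : W ⟶ J.apex) (h : W ⟶ H.apex) (c : W ⟶ C.mor) (e : j ≫ J.right = h ≫ H.left)
      (q : h ≫ H.right = c ≫ C.src), pullback.lift (tens₀ j h e) c (by rw [← q, tens₀_right]) ≫ F =
        tens₀ j (H.ra h c q) (by simpa using e) := by
  have key : ∀ {W : E} (w : W ⟶ pullback (hright J H) C.src) (j : W ⟶ J.apex) (h : W ⟶ H.apex)
      (e : j ≫ J.right = h ≫ H.left) (_ : w ≫ pullback.fst _ _ = tens₀ j h e),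
      h ≫ H.right = (w ≫ pullback.snd _ _) ≫ C.src := by
    intro W w j h e q
    rw [Category.assoc, ← pullback.condition, ← Category.assoc, q, tens₀_right]
  obtain ⟨F, hF⟩ := exists_descOver₀ (pullback.fst (hright J H) C.src)
    (fun w j h e q => tens₀ j (H.ra h (w ≫ pullback.snd _ _) (key w j h e q)) (by simpa using e))
    (by intros; simp [comp_tens₀])
    (by
      intro W w j b h jb bh e e' q q'
      rw [tens₀_bal _ _ _ _ (by simpa using bh)]
      congr 1
      rw [ra_la])
  refine ⟨F, ?_⟩
  intro W j h c e q
  rw [hF _ j h e (by simp)]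
  simp

/-- The left action on the composite: `a · (j ⊗ h) = (a · j) ⊗ h`. -/
def hlact : pullback A.tgt (hleft J H) ⟶ hobj J H := (exists_hlact J H).choose

/-- The right action on the composite: `(j ⊗ h) · c = j ⊗ (h · c)`. -/
def hract : pullback (hright J H) C.src ⟶ hobj J H := (exists_hract J H).choose

variable {J H}

theorem lact_tens₀ (a : X ⟶ A.mor) (j : X ⟶ J.apex) (h : X ⟶ H.apex)
    (e : j ≫ J.right = h ≫ H.left) (q : a ≫ A.tgt = j ≫ J.left)
    (q' : a ≫ A.tgt = tens₀ j h e ≫ hleft J H) :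
    pullback.lift a (tens₀ j h e) q' ≫ hlact J H = tens₀ (J.la a j q) h (by simpa using e) :=
  (exists_hlact J H).choose_spec a j h e q

theorem ract_tens₀ (j : X ⟶ J.apex) (h : X ⟶ H.apex) (c : X ⟶ C.mor)
    (e : j ≫ J.right = h ≫ H.left) (q : h ≫ H.right = c ≫ C.src)
    (q' : tens₀ j h e ≫ hright J H = c ≫ C.src) :
    pullback.lift (tens₀ j h e) c q' ≫ hract J H = tens₀ j (H.ra h c q) (by simpa using e) :=
  (exists_hract J H).choose_spec j h c e q

theorem hlact_hleft : hlact J H ≫ hleft J H = pullback.fst A.tgt (hleft J H) ≫ A.src := by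
  obtain ⟨W, p, j, h, e, _, hp⟩ := exists_cover₀ (pullback.snd A.tgt (hleft J H))
  have q : (p ≫ pullback.fst _ _) ≫ A.tgt = j ≫ J.left := by
    rw [Category.assoc, pullback.condition, ← Category.assoc, hp, tens₀_left]
  have hp' : p = pullback.lift (p ≫ pullback.fst _ _) (tens₀ j h e) (by rw [q, tens₀_left]) := by
    apply pullback.hom_ext <;> simp [hp]
  rw [← cancel_epi p, ← Category.assoc]
  conv_lhs => rw [hp']
  rw [lact_tens₀ _ _ _ _ q, tens₀_left, la_left, Category.assoc]

theorem hlact_hright : hlact J H ≫ hright J H = pullback.snd A.tgt (hleft J H) ≫ hright J H := by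
  obtain ⟨W, p, j, h, e, _, hp⟩ := exists_cover₀ (pullback.snd A.tgt (hleft J H))
  have q : (p ≫ pullback.fst _ _) ≫ A.tgt = j ≫ J.left := by
    rw [Category.assoc, pullback.condition, ← Category.assoc, hp, tens₀_left]
  have hp' : p = pullback.lift (p ≫ pullback.fst _ _) (tens₀ j h e) (by rw [q, tens₀_left]) := by
    apply pullback.hom_ext <;> simp [hp]
  rw [← cancel_epi p, ← Category.assoc, ← Category.assoc, hp, tens₀_right]
  conv_lhs => rw [hp']
  rw [lact_tens₀ _ _ _ _ q, tens₀_right]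

theorem hract_hright : hract J H ≫ hright J H = pullback.snd (hright J H) C.src ≫ C.tgt := by
  obtain ⟨W, p, j, h, e, _, hp⟩ := exists_cover₀ (pullback.fst (hright J H) C.src)
  have q : h ≫ H.right = (p ≫ pullback.snd _ _) ≫ C.src := by
    rw [Category.assoc, ← pullback.condition, ← Category.assoc, hp, tens₀_right]
  have hp' : p = pullback.lift (tens₀ j h e) (p ≫ pullback.snd _ _)
      (by rw [← q, tens₀_right]) := by
    apply pullback.hom_ext <;> simp [hp]
  rw [← cancel_epi p, ← Category.assoc]
  conv_lhs => rw [hp']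
  rw [ract_tens₀ _ _ _ _ q, tens₀_right, ra_right, Category.assoc]

theorem hract_hleft : hract J H ≫ hleft J H = pullback.fst (hright J H) C.src ≫ hleft J H := by
  obtain ⟨W, p, j, h, e, _, hp⟩ := exists_cover₀ (pullback.fst (hright J H) C.src)
  have q : h ≫ H.right = (p ≫ pullback.snd _ _) ≫ C.src := by
    rw [Category.assoc, ← pullback.condition, ← Category.assoc, hp, tens₀_right]
  have hp' : p = pullback.lift (tens₀ j h e) (p ≫ pullback.snd _ _)
      (by rw [← q, tens₀_right]) := by
    apply pullback.hom_ext <;> simp [hp]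
  rw [← cancel_epi p, ← Category.assoc, ← Category.assoc, hp, tens₀_left]
  conv_lhs => rw [hp']
  rw [ract_tens₀ _ _ _ _ q, tens₀_left]

variable (J H)

/-- The horizontal composite of internal profunctors. -/
def hcomp : InternalProf A C where
  apex := hobj J H
  left := hleft J H
  right := hright J H
  lact := hlact J H
  ract := hract J H
  lact_left := hlact_hleft
  lact_right := hlact_hright
  ract_left := hract_hleft
  ract_right := hract_hright
  unit_lact := by
    intro X x
    obtain ⟨W, p, j, h, e, _, hp⟩ := exists_cover₀ x
    rw [← cancel_epi p, ← Category.assoc, comp_lift]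
    simp only [reassoc_of% hp, hp, reassoc_of% (tens₀_left j h e)]
    rw [lact_tens₀ _ _ _ _ (by simp)]
    congr 1
    simp only [← Category.assoc]
    exact la_unit _ _ _
  ract_unit := by
    intro X x
    obtain ⟨W, p, j, h, e, _, hp⟩ := exists_cover₀ x
    rw [← cancel_epi p, ← Category.assoc, comp_lift]
    simp only [reassoc_of% hp, hp, reassoc_of% (tens₀_right j h e)]
    rw [ract_tens₀ _ _ _ _ (by simp)]
    congr 1
    simp only [← Category.assoc]
    exact ra_unit _ _ _
  mul_lact := by
    intro X a a' x k k'
    obtain ⟨W, p, j, h, e, _, hp⟩ := exists_cover₀ x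
    have q' : (p ≫ a') ≫ A.tgt = j ≫ J.left := by
      rw [Category.assoc, k', ← Category.assoc, hp, tens₀_left]
    have q : (p ≫ a) ≫ A.tgt = (p ≫ a') ≫ A.src := by
      rw [Category.assoc, k, Category.assoc]
    rw [← cancel_epi p]
    simp only [← Category.assoc, comp_lift, hp]
    rw [lact_tens₀ _ _ _ _ (by simpa [A.mul_tgt] using q')]
    simp only [lact_tens₀ _ _ _ _ q']
    rw [lact_tens₀ _ _ _ _ (by simpa using q)]
    congr 1
    exact la_comp (p ≫ a) (p ≫ a') j q (by simpa using q')
  ract_mul := by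
    intro X x c c' k k'
    obtain ⟨W, p, j, h, e, _, hp⟩ := exists_cover₀ x
    have q : h ≫ H.right = (p ≫ c) ≫ C.src := by
      rw [Category.assoc, ← k, ← Category.assoc, hp, tens₀_right]
    have q' : (p ≫ c) ≫ C.tgt = (p ≫ c') ≫ C.src := by
      rw [Category.assoc, k', Category.assoc]
    rw [← cancel_epi p]
    simp only [← Category.assoc, comp_lift, hp]
    rw [ract_tens₀ _ _ (pullback.lift (p ≫ c) (p ≫ c') q' ≫ C.mul) _
      (by simpa [C.mul_src] using q)]
    simp only [ract_tens₀ _ _ _ _ q]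
    rw [ract_tens₀ _ _ _ _ (by simpa using q')]
    congr 1
    exact ra_ra h (p ≫ c) (p ≫ c') q (by simpa using q')
  lact_ract := by
    intro X a x c k k'
    obtain ⟨W, p, j, h, e, _, hp⟩ := exists_cover₀ x
    have q : (p ≫ a) ≫ A.tgt = j ≫ J.left := by
      rw [Category.assoc, k, ← Category.assoc, hp, tens₀_left]
    have q' : h ≫ H.right = (p ≫ c) ≫ C.src := by
      rw [Category.assoc, ← k', ← Category.assoc, hp, tens₀_right]
    rw [← cancel_epi p]
    simp only [← Category.assoc, comp_lift, hp]
    simp only [lact_tens₀ _ _ _ _ q, ract_tens₀ _ _ _ _ q']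

end InternalProf

end Composite

section Cells

variable {E : Type u} [Category.{v} E] [HasPullbacks E]

attribute [local simp] pullback.lift_fst pullback.lift_fst_assoc pullback.lift_snd
  pullback.lift_snd_assoc

/-- The identity functor. -/
def InternalFunctor.id (A : InternalCat E) : InternalFunctor A A where
  obj := 𝟙 _
  mor := 𝟙 _
  mor_src := by simp
  mor_tgt := by simp
  unit_mor := by simp
  mul_mor := by simp

/-- Composition of internal functors. -/
def InternalFunctor.then {A B C : InternalCat E} (f : InternalFunctor A B)
    (g : InternalFunctor B C) : InternalFunctor A C where
  obj := f.obj ≫ g.obj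
  mor := f.mor ≫ g.mor
  mor_src := by simp
  mor_tgt := by simp
  unit_mor := by simp
  mul_mor := by
    apply InternalFunctor.mul_mor_of_comp
    simp

/-- Internal categories and internal functors form a category. -/
instance : Category.{v} (InternalCat E) where
  Hom A B := InternalFunctor A B
  id A := InternalFunctor.id A
  comp f g := InternalFunctor.then f g
  id_comp f := by ext <;> simp [InternalFunctor.then, InternalFunctor.id]
  comp_id f := by ext <;> simp [InternalFunctor.then, InternalFunctor.id]
  assoc f g h := by ext <;> simp [InternalFunctor.then]

@[simp] theorem id_obj (A : InternalCat E) : InternalFunctor.obj (𝟙 A) = 𝟙 A.obj := rfl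

@[simp] theorem id_mor (A : InternalCat E) : InternalFunctor.mor (𝟙 A) = 𝟙 A.mor := rfl

@[simp] theorem comp_obj {A B C : InternalCat E} (f : A ⟶ B) (g : B ⟶ C) :
    InternalFunctor.obj (f ≫ g) = InternalFunctor.obj f ≫ InternalFunctor.obj g := rfl

@[simp] theorem comp_mor {A B C : InternalCat E} (f : A ⟶ B) (g : B ⟶ C) :
    InternalFunctor.mor (f ≫ g) = InternalFunctor.mor f ≫ InternalFunctor.mor g := rfl

/-- The type of cells of the double category of internal profunctors. -/
abbrev Trans {A B C D : InternalCat E} (f : A ⟶ C) (g : B ⟶ D) (J : InternalProf A B)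
    (K : InternalProf C D) : Type v := InternalTrans f g J K

namespace InternalTrans

/-- The identity transformation. -/
def id {A B : InternalCat E} (J : InternalProf A B) : Trans (𝟙 A) (𝟙 B) J J :=
  mk' (𝟙 _) (by simp) (by simp) (by intros; simp) (by intros; simp)

/-- Vertical composition of transformations. -/
def vcomp {A B C D X Y : InternalCat E} {f : A ⟶ C} {g : B ⟶ D} {h : C ⟶ X} {k : D ⟶ Y}
    {J : InternalProf A B} {K : InternalProf C D} {L : InternalProf X Y}
    (φ : Trans f g J K) (ψ : Trans h k K L) : Trans (f ≫ h) (g ≫ k) J L :=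
  mk' (φ.hom ≫ ψ.hom) (by simp) (by simp) (by intros; simp) (by intros; simp)

@[simp] theorem id_hom {A B : InternalCat E} (J : InternalProf A B) : (id J).hom = 𝟙 _ := rfl

@[simp] theorem vcomp_hom {A B C D X Y : InternalCat E} {f : A ⟶ C} {g : B ⟶ D} {h : C ⟶ X}
    {k : D ⟶ Y} {J : InternalProf A B} {K : InternalProf C D} {L : InternalProf X Y}
    (φ : Trans f g J K) (ψ : Trans h k K L) : (vcomp φ ψ).hom = φ.hom ≫ ψ.hom := rfl

end InternalTrans

/-- The horizontal unit: an internal category acting on itself. -/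
abbrev InternalProf.hunit (A : InternalCat E) : InternalProf A A where
  apex := A.mor
  left := A.src
  right := A.tgt
  lact := A.mul
  ract := A.mul
  lact_left := A.mul_src
  lact_right := A.mul_tgt
  ract_left := A.mul_src
  ract_right := A.mul_tgt
  unit_lact := A.unit_mul
  ract_unit := A.mul_unit
  mul_lact := A.mul_assoc
  ract_mul := A.mul_assoc
  lact_ract := A.mul_assoc

@[simp] theorem hunit_la {A : InternalCat E} {X : E} (a b : X ⟶ A.mor)
    (h : a ≫ A.tgt = b ≫ A.src) : (InternalProf.hunit A).la a b h = A.comp a b h := rfl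

@[simp] theorem hunit_ra {A : InternalCat E} {X : E} (a b : X ⟶ A.mor)
    (h : a ≫ A.tgt = b ≫ A.src) : (InternalProf.hunit A).ra a b h = A.comp a b h := rfl

theorem unit_comp {A : InternalCat E} {X : E} (a : X ⟶ A.obj) (b : X ⟶ A.mor)
    (h : (a ≫ A.unit) ≫ A.tgt = b ≫ A.src) : A.comp (a ≫ A.unit) b h = b :=
  InternalProf.la_unit (J := InternalProf.hunit A) a b h

theorem comp_unit {A : InternalCat E} {X : E} (a : X ⟶ A.obj) (b : X ⟶ A.mor)
    (h : b ≫ A.tgt = (a ≫ A.unit) ≫ A.src) : A.comp b (a ≫ A.unit) h = b :=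
  InternalProf.ra_unit (J := InternalProf.hunit A) b a h

/-- The horizontal unit transformation of an internal functor. -/
def InternalTrans.hunit {A C : InternalCat E} (f : A ⟶ C) :
    Trans f f (InternalProf.hunit A) (InternalProf.hunit C) :=
  InternalTrans.mk' f.mor (by simp) (by simp) (by intros; simp) (by intros; simp)

@[simp] theorem InternalTrans.hunit_hom {A C : InternalCat E} (f : A ⟶ C) :
    (InternalTrans.hunit f).hom = f.mor := rfl

section Composite

variable [HasCoequalizers E] [CoequalizersPreservedByPullback E]

namespace InternalProf

variable {A B C D : InternalCat E} {J : InternalProf A B} {H : InternalProf B C}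
  {K : InternalProf C D} {X W : E}

/-- The element `j ⊗ h` of the composite profunctor. -/
def tens (j : X ⟶ J.apex) (h : X ⟶ H.apex) (e : j ≫ J.right = h ≫ H.left) :
    X ⟶ (hcomp J H).apex := tens₀ j h e

@[simp] theorem comp_tens (w : W ⟶ X) (j : X ⟶ J.apex) (h : X ⟶ H.apex)
    (e : j ≫ J.right = h ≫ H.left) : w ≫ tens j h e =
      tens (w ≫ j) (w ≫ h) (by simp only [Category.assoc, e]) := comp_tens₀ w j h e

@[simp] theorem comp_tens_assoc (w : W ⟶ X) (j : X ⟶ J.apex) (h : X ⟶ H.apex)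
    (e : j ≫ J.right = h ≫ H.left) {Z : E} (z : (hcomp J H).apex ⟶ Z) : w ≫ tens j h e ≫ z =
      tens (w ≫ j) (w ≫ h) (by simp only [Category.assoc, e]) ≫ z := by
  rw [← Category.assoc, comp_tens]

@[simp] theorem tens_left (j : X ⟶ J.apex) (h : X ⟶ H.apex) (e : j ≫ J.right = h ≫ H.left) :
    tens j h e ≫ (hcomp J H).left = j ≫ J.left := tens₀_left j h e

@[simp] theorem tens_right (j : X ⟶ J.apex) (h : X ⟶ H.apex) (e : j ≫ J.right = h ≫ H.left) :
    tens j h e ≫ (hcomp J H).right = h ≫ H.right := tens₀_right j h e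

@[simp] theorem tens_left_assoc (j : X ⟶ J.apex) (h : X ⟶ H.apex)
    (e : j ≫ J.right = h ≫ H.left) {Z : E} (z : A.obj ⟶ Z) :
    tens j h e ≫ (hcomp J H).left ≫ z = j ≫ J.left ≫ z := by
  rw [← Category.assoc, tens_left, Category.assoc]

@[simp] theorem tens_right_assoc (j : X ⟶ J.apex) (h : X ⟶ H.apex)
    (e : j ≫ J.right = h ≫ H.left) {Z : E} (z : C.obj ⟶ Z) :
    tens j h e ≫ (hcomp J H).right ≫ z = h ≫ H.right ≫ z := by
  rw [← Category.assoc, tens_right, Category.assoc]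

theorem tens_bal (j : X ⟶ J.apex) (b : X ⟶ B.mor) (h : X ⟶ H.apex)
    (jb : j ≫ J.right = b ≫ B.src) (bh : b ≫ B.tgt = h ≫ H.left) :
    tens (J.ra j b jb) h (by simp [bh]) = tens j (H.la b h bh) (by simp [jb]) :=
  tens₀_bal j b h jb bh

@[simp] theorem la_tens (a : X ⟶ A.mor) (j : X ⟶ J.apex) (h : X ⟶ H.apex)
    (e : j ≫ J.right = h ≫ H.left) (q : a ≫ A.tgt = tens j h e ≫ (hcomp J H).left) :
    (hcomp J H).la a (tens j h e) q = tens (J.la a j (by simpa using q)) h (by simpa using e) :=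
  lact_tens₀ a j h e (by simpa using q) q

@[simp] theorem ra_tens (j : X ⟶ J.apex) (h : X ⟶ H.apex) (c : X ⟶ C.mor)
    (e : j ≫ J.right = h ≫ H.left) (q : tens j h e ≫ (hcomp J H).right = c ≫ C.src) :
    (hcomp J H).ra (tens j h e) c q = tens j (H.ra h c (by simpa using q)) (by simpa using e) :=
  ract_tens₀ j h c e (by simpa using q) q

theorem exists_cover (x : X ⟶ (hcomp J H).apex) :
    ∃ (W : E) (p : W ⟶ X) (j : W ⟶ J.apex) (h : W ⟶ H.apex) (e : j ≫ J.right = h ≫ H.left),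
      Epi p ∧ p ≫ x = tens j h e := exists_cover₀ x

theorem tens_congr {j j' : X ⟶ J.apex} {h h' : X ⟶ H.apex} (e : j ≫ J.right = h ≫ H.left)
    (hj : j = j') (hh : h = h') : tens j h e = tens j' h' (by rw [← hj, ← hh, e]) := by
  subst hj hh
  rfl

/-- Maps out of a composite agree if they agree on elements `j ⊗ h`. -/
theorem hcomp_hom_ext {Z : E} {F G : (hcomp J H).apex ⟶ Z}
    (hFG : ∀ {W : E} (j : W ⟶ J.apex) (h : W ⟶ H.apex) (e : j ≫ J.right = h ≫ H.left),
      tens j h e ≫ F = tens j h e ≫ G) : F = G := by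
  obtain ⟨W, p, j, h, e, _, hp⟩ := exists_cover (𝟙 (hcomp J H).apex)
  rw [Category.comp_id] at hp
  rw [← cancel_epi p, hp, hFG]

/-- A transformation out of a composite, from conditions on elements `j ⊗ h`. -/
def transOfTens {X Y : InternalCat E} {f : A ⟶ X} {g : C ⟶ Y} {L : InternalProf X Y}
    (F : (hcomp J H).apex ⟶ L.apex)
    (hl : ∀ {W : E} (j : W ⟶ J.apex) (h : W ⟶ H.apex) (e : j ≫ J.right = h ≫ H.left),
      tens j h e ≫ F ≫ L.left = j ≫ J.left ≫ f.obj)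
    (hr : ∀ {W : E} (j : W ⟶ J.apex) (h : W ⟶ H.apex) (e : j ≫ J.right = h ≫ H.left),
      tens j h e ≫ F ≫ L.right = h ≫ H.right ≫ g.obj)
    (hla : ∀ {W : E} (a : W ⟶ A.mor) (j : W ⟶ J.apex) (h : W ⟶ H.apex)
      (e : j ≫ J.right = h ≫ H.left) (q : a ≫ A.tgt = j ≫ J.left),
      tens (J.la a j q) h (by simpa using e) ≫ F =
        L.la (a ≫ f.mor) (tens j h e ≫ F) (by simp [hl, reassoc_of% q]))
    (hra : ∀ {W : E} (j : W ⟶ J.apex) (h : W ⟶ H.apex) (c : W ⟶ C.mor)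
      (e : j ≫ J.right = h ≫ H.left) (q : h ≫ H.right = c ≫ C.src),
      tens j (H.ra h c q) (by simpa using e) ≫ F =
        L.ra (tens j h e ≫ F) (c ≫ g.mor) (by simp [hr, reassoc_of% q])) :
    Trans f g (hcomp J H) L :=
  InternalTrans.mk' F (hcomp_hom_ext (by intros; simp [hl])) (hcomp_hom_ext (by intros; simp [hr]))
    (by
      intro X a x q
      obtain ⟨W, p, j, h, e, _, hp⟩ := exists_cover x
      have q' : (p ≫ a) ≫ A.tgt = j ≫ J.left := by
        rw [Category.assoc, q, ← Category.assoc, hp, tens_left]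
      rw [← cancel_epi p]
      simp only [comp_la_assoc, comp_la, hp, la_tens, reassoc_of% hp]
      rw [hla _ _ _ e q']
      simp only [Category.assoc])
    (by
      intro X x c q
      obtain ⟨W, p, j, h, e, _, hp⟩ := exists_cover x
      have q' : h ≫ H.right = (p ≫ c) ≫ C.src := by
        rw [Category.assoc, ← q, ← Category.assoc, hp, tens_right]
      rw [← cancel_epi p]
      simp only [comp_ra_assoc, comp_ra, hp, ra_tens, reassoc_of% hp]
      rw [hra _ _ _ e q']
      simp only [Category.assoc])

@[simp] theorem transOfTens_hom {X Y : InternalCat E} {f : A ⟶ X} {g : C ⟶ Y}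
    {L : InternalProf X Y} (F : (hcomp J H).apex ⟶ L.apex) (hl hr hla hra) :
    (transOfTens (f := f) (g := g) F hl hr hla hra).hom = F := rfl

end InternalProf

end Composite

end Cells

section Structure

variable {E : Type u} [Category.{v} E] [HasPullbacks E] [HasCoequalizers E]
  [CoequalizersPreservedByPullback E]

attribute [local simp] pullback.lift_fst pullback.lift_fst_assoc pullback.lift_snd
  pullback.lift_snd_assoc

open InternalProf

namespace InternalTrans

section HComp

variable {A B C D X Y : InternalCat E} {f : A ⟶ D} {g : B ⟶ X} {h : C ⟶ Y}
  {J : InternalProf A B} {H : InternalProf B C} {K : InternalProf D X} {L : InternalProf X Y}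
  (φ : Trans f g J K) (χ : Trans g h H L)

theorem exists_hcomp : ∃ F : (InternalProf.hcomp J H).apex ⟶ (InternalProf.hcomp K L).apex,
    ∀ {W : E} (j : W ⟶ J.apex) (h : W ⟶ H.apex) (e : j ≫ J.right = h ≫ H.left),
      tens j h e ≫ F = tens (j ≫ φ.hom) (h ≫ χ.hom) (by simp [reassoc_of% e]) :=
  exists_desc₀ (fun j h e => tens (j ≫ φ.hom) (h ≫ χ.hom) (by simp [reassoc_of% e]))
    (by intros; simp)
    (by
      intro W j b h jb bh e e'
      simp only [ra_hom, la_hom]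
      exact tens_bal _ _ _ _ _)

/-- Horizontal composition of transformations: `j ⊗ h ↦ φ j ⊗ χ h`. -/
def hcomp : Trans f h (InternalProf.hcomp J H) (InternalProf.hcomp K L) :=
  transOfTens (exists_hcomp φ χ).choose
    (by intro W j h e; rw [reassoc_of% ((exists_hcomp φ χ).choose_spec j h e)]; simp)
    (by intro W j h e; rw [reassoc_of% ((exists_hcomp φ χ).choose_spec j h e)]; simp)
    (by intros; simp [(exists_hcomp φ χ).choose_spec])
    (by intros; simp [(exists_hcomp φ χ).choose_spec])

@[simp] theorem tens_hcomp {W : E} (j : W ⟶ J.apex) (h : W ⟶ H.apex)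
    (e : j ≫ J.right = h ≫ H.left) : tens j h e ≫ (hcomp φ χ).hom =
      tens (j ≫ φ.hom) (h ≫ χ.hom) (by simp [reassoc_of% e]) :=
  (exists_hcomp φ χ).choose_spec j h e

@[simp] theorem tens_hcomp_assoc {W : E} (j : W ⟶ J.apex) (h : W ⟶ H.apex)
    (e : j ≫ J.right = h ≫ H.left) {Z : E} (z : (InternalProf.hcomp K L).apex ⟶ Z) :
    tens j h e ≫ (hcomp φ χ).hom ≫ z =
      tens (j ≫ φ.hom) (h ≫ χ.hom) (by simp [reassoc_of% e]) ≫ z := by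
  rw [← Category.assoc, tens_hcomp]

end HComp

section Unitors

variable {A B : InternalCat E} (M : InternalProf A B)

theorem exists_lunit : ∃ F : (InternalProf.hcomp (InternalProf.hunit A) M).apex ⟶ M.apex,
    ∀ {W : E} (a : W ⟶ A.mor) (m : W ⟶ M.apex) (e : a ≫ A.tgt = m ≫ M.left),
      tens (J := InternalProf.hunit A) a m e ≫ F = M.la a m e :=
  exists_desc₀ (J := InternalProf.hunit A) (fun a m e => M.la a m e)
    (by intros; simp)
    (by intros; simp only [hunit_ra]; exact la_comp _ _ _ _ _)

/-- The left unitor `a ⊗ m ↦ a · m`. -/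
def lunit : Trans (𝟙 A) (𝟙 B) (InternalProf.hcomp (InternalProf.hunit A) M) M :=
  transOfTens (exists_lunit M).choose
    (by intro W j h e; rw [reassoc_of% ((exists_lunit M).choose_spec j h e)]; simp)
    (by intro W j h e; rw [reassoc_of% ((exists_lunit M).choose_spec j h e)]; simp)
    (by
      intro W a j h e q
      simp only [hunit_la, (exists_lunit M).choose_spec, id_mor, Category.comp_id]
      exact la_comp _ _ _ _ _)
    (by intros; simp [(exists_lunit M).choose_spec, ra_la])

@[simp] theorem tens_lunit {W : E} (a : W ⟶ A.mor) (m : W ⟶ M.apex)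
    (e : a ≫ A.tgt = m ≫ M.left) :
    tens (J := InternalProf.hunit A) a m e ≫ (lunit M).hom = M.la a m e :=
  (exists_lunit M).choose_spec a m e

@[simp] theorem tens_lunit_assoc {W Z : E} (a : W ⟶ A.mor) (m : W ⟶ M.apex)
    (e : a ≫ A.tgt = m ≫ M.left) (z : M.apex ⟶ Z) :
    tens (J := InternalProf.hunit A) a m e ≫ (lunit M).hom ≫ z = M.la a m e ≫ z := by
  rw [← Category.assoc, tens_lunit]

theorem exists_runit : ∃ F : (InternalProf.hcomp M (InternalProf.hunit B)).apex ⟶ M.apex,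
    ∀ {W : E} (m : W ⟶ M.apex) (b : W ⟶ B.mor) (e : m ≫ M.right = b ≫ B.src),
      tens (H := InternalProf.hunit B) m b e ≫ F = M.ra m b e :=
  exists_desc₀ (H := InternalProf.hunit B) (fun m b e => M.ra m b e)
    (by intros; simp)
    (by intros; simp only [hunit_la]; exact ra_ra _ _ _ _ _)

/-- The right unitor `m ⊗ b ↦ m · b`. -/
def runit : Trans (𝟙 A) (𝟙 B) (InternalProf.hcomp M (InternalProf.hunit B)) M :=
  transOfTens (exists_runit M).choose
    (by intro W j h e; rw [reassoc_of% ((exists_runit M).choose_spec j h e)]; simp)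
    (by intro W j h e; rw [reassoc_of% ((exists_runit M).choose_spec j h e)]; simp)
    (by intros; simp [(exists_runit M).choose_spec, ra_la])
    (by
      intro W a j h e q
      simp only [hunit_ra, (exists_runit M).choose_spec, id_mor, Category.comp_id]
      exact (ra_ra _ _ _ _ _).symm)

@[simp] theorem tens_runit {W : E} (m : W ⟶ M.apex) (b : W ⟶ B.mor)
    (e : m ≫ M.right = b ≫ B.src) :
    tens (H := InternalProf.hunit B) m b e ≫ (runit M).hom = M.ra m b e :=
  (exists_runit M).choose_spec m b e

@[simp] theorem tens_runit_assoc {W Z : E} (m : W ⟶ M.apex) (b : W ⟶ B.mor)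
    (e : m ≫ M.right = b ≫ B.src) (z : M.apex ⟶ Z) :
    tens (H := InternalProf.hunit B) m b e ≫ (runit M).hom ≫ z = M.ra m b e ≫ z := by
  rw [← Category.assoc, tens_runit]

/-- The inverse left unitor `m ↦ 1 ⊗ m`. -/
def lunitInv : Trans (𝟙 A) (𝟙 B) M (InternalProf.hcomp (InternalProf.hunit A) M) :=
  mk' (tens (J := InternalProf.hunit A) (M.left ≫ A.unit) (𝟙 _) (by simp)) (by simp) (by simp)
    (by
      intro X a j h
      simp only [comp_tens, la_left_assoc, Category.comp_id, id_mor, la_tens, hunit_la]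
      have := tens_bal (J := InternalProf.hunit A) (H := M) (a ≫ A.src ≫ A.unit) a j (by simp) h
      simp only [hunit_ra, ← Category.assoc, unit_comp] at this
      refine Eq.trans ?_ (this.symm.trans ?_)
      · exact tens_congr _ (by simp) rfl
      · refine tens_congr _ ?_ rfl
        simp only [← Category.assoc, ← h, comp_unit])
    (by intros; simp)

@[simp] theorem comp_lunitInv {W : E} (m : W ⟶ M.apex) : m ≫ (lunitInv M).hom =
    tens (J := InternalProf.hunit A) (m ≫ M.left ≫ A.unit) m (by simp) := by
  change m ≫ tens _ _ _ = _
  simp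

@[simp] theorem comp_lunitInv_assoc {W : E} (m : W ⟶ M.apex) {Z : E} (z : _ ⟶ Z) :
    m ≫ (lunitInv M).hom ≫ z =
      tens (J := InternalProf.hunit A) (m ≫ M.left ≫ A.unit) m (by simp) ≫ z := by
  rw [← Category.assoc, comp_lunitInv]

/-- The inverse right unitor `m ↦ m ⊗ 1`. -/
def runitInv : Trans (𝟙 A) (𝟙 B) M (InternalProf.hcomp M (InternalProf.hunit B)) :=
  mk' (tens (H := InternalProf.hunit B) (𝟙 _) (M.right ≫ B.unit) (by simp)) (by simp) (by simp)
    (by intros; simp)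
    (by
      intro X j b h
      simp only [comp_tens, ra_right_assoc, Category.comp_id, id_mor, ra_tens, hunit_ra]
      have := tens_bal (J := M) (H := InternalProf.hunit B) j b (b ≫ B.tgt ≫ B.unit) h (by simp)
      refine Eq.trans ?_ (this.trans ?_)
      · exact tens_congr _ rfl (by simp)
      · refine tens_congr _ rfl ?_
        simp only [hunit_la, ← Category.assoc, h, comp_unit, unit_comp])

@[simp] theorem comp_runitInv {W : E} (m : W ⟶ M.apex) : m ≫ (runitInv M).hom =
    tens (H := InternalProf.hunit B) m (m ≫ M.right ≫ B.unit) (by simp) := by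
  change m ≫ tens _ _ _ = _
  simp

@[simp] theorem comp_runitInv_assoc {W : E} (m : W ⟶ M.apex) {Z : E} (z : _ ⟶ Z) :
    m ≫ (runitInv M).hom ≫ z =
      tens (H := InternalProf.hunit B) m (m ≫ M.right ≫ B.unit) (by simp) ≫ z := by
  rw [← Category.assoc, comp_runitInv]

end Unitors

section Assoc

variable {A B C D : InternalCat E} (J : InternalProf A B) (H : InternalProf B C)
  (K : InternalProf C D)

theorem exists_assoc₀ : ∃ F : pullback (InternalProf.hcomp J H).right K.left ⟶
      (InternalProf.hcomp J (InternalProf.hcomp H K)).apex,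
    ∀ {W : E} (j : W ⟶ J.apex) (h : W ⟶ H.apex) (k : W ⟶ K.apex) (e : j ≫ J.right = h ≫ H.left)
      (e' : h ≫ H.right = k ≫ K.left),
      pullback.lift (tens j h e) k (by simp [e']) ≫ F = tens j (tens h k e') (by simp [e]) := by
  have key : ∀ {W : E} (w : W ⟶ pullback (InternalProf.hcomp J H).right K.left)
      (j : W ⟶ J.apex) (h : W ⟶ H.apex) (e : j ≫ J.right = h ≫ H.left)
      (_ : w ≫ pullback.fst _ _ = tens₀ j h e),
      h ≫ H.right = (w ≫ pullback.snd _ _) ≫ K.left := by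
    intro W w j h e q
    rw [Category.assoc, ← pullback.condition, ← Category.assoc, q]
    exact (tens₀_right j h e).symm
  obtain ⟨F, hF⟩ := exists_descOver₀ (pullback.fst (InternalProf.hcomp J H).right K.left)
    (fun w j h e q => tens j (tens h (w ≫ pullback.snd _ _) (key w j h e q)) (by simp [e]))
    (by intros; simp)
    (by
      intro W w j b h jb bh e e' q q'
      rw [tens_bal _ _ _ _ (by simp [bh])]
      simp)
  refine ⟨F, ?_⟩
  intro W j h k e e'
  refine (hF (pullback.lift (tens j h e) k (by simp [e'])) j h e (pullback.lift_fst _ _ _)).trans ?_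
  simp

theorem exists_assoc : ∃ F : (InternalProf.hcomp (InternalProf.hcomp J H) K).apex ⟶
      (InternalProf.hcomp J (InternalProf.hcomp H K)).apex,
    ∀ {W : E} (j : W ⟶ J.apex) (h : W ⟶ H.apex) (k : W ⟶ K.apex) (e : j ≫ J.right = h ≫ H.left)
      (e' : h ≫ H.right = k ≫ K.left),
      tens (tens j h e) k (by simp [e']) ≫ F = tens j (tens h k e') (by simp [e]) := by
  obtain ⟨G, hG⟩ := exists_assoc₀ J H K
  obtain ⟨F, hF⟩ := exists_desc₀ (J := InternalProf.hcomp J H) (H := K)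
    (fun t k e => pullback.lift t k e ≫ G)
    (by intros; simp only [← Category.assoc, comp_lift])
    (by
      intro W t c k jb bh e e'
      obtain ⟨V, p, j, h, e₀, _, hp⟩ := exists_cover t
      have e₁ : h ≫ H.right = (p ≫ c) ≫ C.src := by
        rw [Category.assoc, ← jb, ← Category.assoc, hp, tens_right]
      have e₂ : (p ≫ c) ≫ C.tgt = (p ≫ k) ≫ K.left := by
        rw [Category.assoc, bh, Category.assoc]
      rw [← cancel_epi p, ← Category.assoc, ← Category.assoc, comp_lift, comp_lift]
      simp only [comp_ra, comp_la, hp, ra_tens]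
      rw [hG _ _ _ _ (by simpa using e₂), hG _ _ _ _ (by simpa using e₁)]
      exact tens_congr _ rfl (tens_bal _ _ _ e₁ e₂))
  refine ⟨F, ?_⟩
  intro W j h k e e'
  exact (hF (tens j h e) k (by simp [e'])).trans (hG j h k e e')

/-- The associator `(j ⊗ h) ⊗ k ↦ j ⊗ (h ⊗ k)`. -/
def assoc : Trans (𝟙 A) (𝟙 D) (InternalProf.hcomp (InternalProf.hcomp J H) K)
    (InternalProf.hcomp J (InternalProf.hcomp H K)) := by
  have hF := @Exists.choose_spec _ _ (exists_assoc J H K)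
  refine transOfTens (exists_assoc J H K).choose ?_ ?_ ?_ ?_
  · intro W t k e
    obtain ⟨V, p, j, h, e₀, _, hp⟩ := exists_cover t
    have e₁ : h ≫ H.right = (p ≫ k) ≫ K.left := by
      rw [Category.assoc, ← e, ← Category.assoc, hp, tens_right]
    rw [← cancel_epi p]
    simp [hp, reassoc_of% hp, reassoc_of% (hF j h (p ≫ k) e₀ e₁)]
  · intro W t k e
    obtain ⟨V, p, j, h, e₀, _, hp⟩ := exists_cover t
    have e₁ : h ≫ H.right = (p ≫ k) ≫ K.left := by
      rw [Category.assoc, ← e, ← Category.assoc, hp, tens_right]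
    rw [← cancel_epi p]
    simp [hp, reassoc_of% (hF j h (p ≫ k) e₀ e₁)]
  · intro W a t k e q
    obtain ⟨V, p, j, h, e₀, _, hp⟩ := exists_cover t
    have e₁ : h ≫ H.right = (p ≫ k) ≫ K.left := by
      rw [Category.assoc, ← e, ← Category.assoc, hp, tens_right]
    have q₁ : (p ≫ a) ≫ A.tgt = j ≫ J.left := by
      rw [Category.assoc, q, ← Category.assoc, hp, tens_left]
    rw [← cancel_epi p]
    simp [hp, hF j h (p ≫ k) e₀ e₁, hF (J.la (p ≫ a) j q₁) h (p ≫ k) (by simpa using e₀) e₁]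
  · intro W t k d e q
    obtain ⟨V, p, j, h, e₀, _, hp⟩ := exists_cover t
    have e₁ : h ≫ H.right = (p ≫ k) ≫ K.left := by
      rw [Category.assoc, ← e, ← Category.assoc, hp, tens_right]
    have q₁ : (p ≫ k) ≫ K.right = (p ≫ d) ≫ D.src := by
      rw [Category.assoc, q, Category.assoc]
    rw [← cancel_epi p]
    simp [hp, hF j h (p ≫ k) e₀ e₁, hF j h (K.ra (p ≫ k) (p ≫ d) q₁) e₀ (by simpa using e₁)]

@[simp] theorem tens_assoc {W : E} (j : W ⟶ J.apex) (h : W ⟶ H.apex) (k : W ⟶ K.apex)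
    (e : j ≫ J.right = h ≫ H.left) (e' : tens j h e ≫ (InternalProf.hcomp J H).right =
      k ≫ K.left) : tens (tens j h e) k e' ≫ (assoc J H K).hom =
        tens j (tens h k (by simpa using e')) (by simp [e]) :=
  (exists_assoc J H K).choose_spec j h k e (by simpa using e')

@[simp] theorem tens_assoc_assoc {W : E} (j : W ⟶ J.apex) (h : W ⟶ H.apex) (k : W ⟶ K.apex)
    (e : j ≫ J.right = h ≫ H.left) (e' : tens j h e ≫ (InternalProf.hcomp J H).right =
      k ≫ K.left) {Z : E} (z : _ ⟶ Z) : tens (tens j h e) k e' ≫ (assoc J H K).hom ≫ z =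
        tens j (tens h k (by simpa using e')) (by simp [e]) ≫ z := by
  rw [← Category.assoc, tens_assoc]

theorem exists_assocInv₀ : ∃ F : pullback J.right (InternalProf.hcomp H K).left ⟶
      (InternalProf.hcomp (InternalProf.hcomp J H) K).apex,
    ∀ {W : E} (j : W ⟶ J.apex) (h : W ⟶ H.apex) (k : W ⟶ K.apex) (e : j ≫ J.right = h ≫ H.left)
      (e' : h ≫ H.right = k ≫ K.left),
      pullback.lift j (tens h k e') (by simp [e]) ≫ F = tens (tens j h e) k (by simp [e']) := by
  have key : ∀ {W : E} (w : W ⟶ pullback J.right (InternalProf.hcomp H K).left)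
      (h : W ⟶ H.apex) (k : W ⟶ K.apex) (e : h ≫ H.right = k ≫ K.left)
      (_ : w ≫ pullback.snd _ _ = tens₀ h k e),
      (w ≫ pullback.fst _ _) ≫ J.right = h ≫ H.left := by
    intro W w j h e q
    rw [Category.assoc, pullback.condition, ← Category.assoc, q]
    exact tens₀_left j h e
  obtain ⟨F, hF⟩ := exists_descOver₀ (pullback.snd J.right (InternalProf.hcomp H K).left)
    (fun w h k e q => tens (tens (w ≫ pullback.fst _ _) h (key w h k e q)) k (by simp [e]))
    (by intros; simp)
    (by
      intro W w j b h jb bh e e' q q'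
      rw [← tens_bal _ _ _ (by simp [jb])]
      simp)
  refine ⟨F, ?_⟩
  intro W j h k e e'
  refine (hF (pullback.lift j (tens h k e') (by simp [e])) h k e' (pullback.lift_snd _ _ _)).trans ?_
  simp

theorem exists_assocInv : ∃ F : (InternalProf.hcomp J (InternalProf.hcomp H K)).apex ⟶
      (InternalProf.hcomp (InternalProf.hcomp J H) K).apex,
    ∀ {W : E} (j : W ⟶ J.apex) (h : W ⟶ H.apex) (k : W ⟶ K.apex) (e : j ≫ J.right = h ≫ H.left)
      (e' : h ≫ H.right = k ≫ K.left),
      tens j (tens h k e') (by simp [e]) ≫ F = tens (tens j h e) k (by simp [e']) := by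
  obtain ⟨G, hG⟩ := exists_assocInv₀ J H K
  obtain ⟨F, hF⟩ := exists_desc₀ (J := J) (H := InternalProf.hcomp H K)
    (fun j t e => pullback.lift j t e ≫ G)
    (by intros; simp only [← Category.assoc, comp_lift])
    (by
      intro W j b t jb bh e e'
      obtain ⟨V, p, h, k, e₀, _, hp⟩ := exists_cover t
      have e₁ : (p ≫ j) ≫ J.right = (p ≫ b) ≫ B.src := by
        rw [Category.assoc, jb, Category.assoc]
      have e₂ : (p ≫ b) ≫ B.tgt = h ≫ H.left := by
        rw [Category.assoc, bh, ← Category.assoc, hp, tens_left]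
      rw [← cancel_epi p, ← Category.assoc, ← Category.assoc, comp_lift, comp_lift]
      simp only [comp_ra, comp_la, hp, la_tens]
      rw [hG _ _ _ (by simpa using e₂), hG _ _ _ (by simpa using e₁)]
      exact tens_congr _ (tens_bal _ _ _ e₁ e₂) rfl)
  refine ⟨F, ?_⟩
  intro W j h k e e'
  exact (hF j (tens h k e') (by simp [e])).trans (hG j h k e e')

/-- The inverse associator `j ⊗ (h ⊗ k) ↦ (j ⊗ h) ⊗ k`. -/
def assocInv : Trans (𝟙 A) (𝟙 D) (InternalProf.hcomp J (InternalProf.hcomp H K))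
    (InternalProf.hcomp (InternalProf.hcomp J H) K) := by
  have hF := @Exists.choose_spec _ _ (exists_assocInv J H K)
  refine transOfTens (exists_assocInv J H K).choose ?_ ?_ ?_ ?_
  · intro W j t e
    obtain ⟨V, p, h, k, e₀, _, hp⟩ := exists_cover t
    have e₁ : (p ≫ j) ≫ J.right = h ≫ H.left := by
      rw [Category.assoc, e, ← Category.assoc, hp, tens_left]
    rw [← cancel_epi p]
    simp [hp, reassoc_of% (hF (p ≫ j) h k e₁ e₀)]
  · intro W j t e
    obtain ⟨V, p, h, k, e₀, _, hp⟩ := exists_cover t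
    have e₁ : (p ≫ j) ≫ J.right = h ≫ H.left := by
      rw [Category.assoc, e, ← Category.assoc, hp, tens_left]
    rw [← cancel_epi p]
    simp [hp, reassoc_of% hp, reassoc_of% (hF (p ≫ j) h k e₁ e₀)]
  · intro W a j t e q
    obtain ⟨V, p, h, k, e₀, _, hp⟩ := exists_cover t
    have e₁ : (p ≫ j) ≫ J.right = h ≫ H.left := by
      rw [Category.assoc, e, ← Category.assoc, hp, tens_left]
    have q₁ : (p ≫ a) ≫ A.tgt = (p ≫ j) ≫ J.left := by
      rw [Category.assoc, q, Category.assoc]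
    rw [← cancel_epi p]
    simp [hp, hF (p ≫ j) h k e₁ e₀, hF (J.la (p ≫ a) (p ≫ j) q₁) h k (by simpa using e₁) e₀]
  · intro W j t d e q
    obtain ⟨V, p, h, k, e₀, _, hp⟩ := exists_cover t
    have e₁ : (p ≫ j) ≫ J.right = h ≫ H.left := by
      rw [Category.assoc, e, ← Category.assoc, hp, tens_left]
    have q₁ : k ≫ K.right = (p ≫ d) ≫ D.src := by
      rw [Category.assoc, ← q, ← Category.assoc, hp, tens_right]
    rw [← cancel_epi p]
    simp [hp, hF (p ≫ j) h k e₁ e₀, hF (p ≫ j) h (K.ra k (p ≫ d) q₁) e₁ (by simpa using e₀)]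

@[simp] theorem tens_assocInv {W : E} (j : W ⟶ J.apex) (h : W ⟶ H.apex) (k : W ⟶ K.apex)
    (e : h ≫ H.right = k ≫ K.left) (e' : j ≫ J.right =
      tens h k e ≫ (InternalProf.hcomp H K).left) : tens j (tens h k e) e' ≫ (assocInv J H K).hom =
        tens (tens j h (by simpa using e')) k (by simp [e]) :=
  (exists_assocInv J H K).choose_spec j h k (by simpa using e') e

end Assoc

end InternalTrans

end Structure

section Laws

attribute [local simp] pullback.lift_fst pullback.lift_fst_assoc pullback.lift_snd
  pullback.lift_snd_assoc

open InternalProf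

namespace InternalTrans

theorem trans_heq {E : Type u} [Category.{v} E] [HasPullbacks E] {A B C D : InternalCat E}
    {f f' : A ⟶ C} {g g' : B ⟶ D} {J : InternalProf A B} {K : InternalProf C D}
    (φ : Trans f g J K) (ψ : Trans f' g' J K)
    (hf : f = f') (hg : g = g') (h : φ.hom = ψ.hom) : φ ≍ ψ :=
  InternalTrans.heq_of_hom φ ψ hf hg h

variable {E : Type u} [Category.{v} E] [HasPullbacks E] [HasCoequalizers E]
  [CoequalizersPreservedByPullback E]

theorem hcomp_id {A B C : InternalCat E} (J : InternalProf A B) (H : InternalProf B C) :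
    hcomp (id J) (id H) = id (InternalProf.hcomp J H) :=
  InternalTrans.ext (hcomp_hom_ext (by intros; simp))

theorem interchange {A B C D X Y A' B' C' : InternalCat E} {f : A ⟶ D} {g : B ⟶ X} {h : C ⟶ Y}
    {f' : D ⟶ A'} {g' : X ⟶ B'} {h' : Y ⟶ C'} {J : InternalProf A B} {H : InternalProf B C}
    {K : InternalProf D X} {L : InternalProf X Y} {M : InternalProf A' B'}
    {N : InternalProf B' C'} (φ : Trans f g J K) (χ : Trans g h H L) (ψ : Trans f' g' K M)
    (ξ : Trans g' h' L N) :
    hcomp (vcomp φ ψ) (vcomp χ ξ) = vcomp (hcomp φ χ) (hcomp ψ ξ) :=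
  InternalTrans.ext (hcomp_hom_ext (by intros; simp))

theorem assoc_assocInv {A B C D : InternalCat E} (J : InternalProf A B) (H : InternalProf B C)
    (K : InternalProf C D) :
    vcomp (assoc J H K) (assocInv J H K) ≍
      id (InternalProf.hcomp (InternalProf.hcomp J H) K) := by
  refine trans_heq _ _ (by simp) (by simp) (hcomp_hom_ext ?_)
  intro W t k e
  obtain ⟨V, p, j, h, e₀, _, hp⟩ := exists_cover t
  rw [← cancel_epi p]
  simp [hp]

theorem assocInv_assoc {A B C D : InternalCat E} (J : InternalProf A B) (H : InternalProf B C)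
    (K : InternalProf C D) :
    vcomp (assocInv J H K) (assoc J H K) ≍
      id (InternalProf.hcomp J (InternalProf.hcomp H K)) := by
  refine trans_heq _ _ (by simp) (by simp) (hcomp_hom_ext ?_)
  intro W j t e
  obtain ⟨V, p, h, k, e₀, _, hp⟩ := exists_cover t
  rw [← cancel_epi p]
  simp only [vcomp_hom, id_hom, Category.comp_id, comp_tens, comp_tens_assoc, hp]
  rw [← Category.assoc, tens_assocInv, tens_assoc]

theorem assoc_natural {A B C D A' B' C' D' : InternalCat E} {f : A ⟶ A'} {g : B ⟶ B'}
    {h : C ⟶ C'} {k : D ⟶ D'} {J : InternalProf A B} {H : InternalProf B C}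
    {K : InternalProf C D} {J' : InternalProf A' B'} {H' : InternalProf B' C'}
    {K' : InternalProf C' D'} (φ : Trans f g J J') (χ : Trans g h H H') (ψ : Trans h k K K') :
    vcomp (hcomp (hcomp φ χ) ψ) (assoc J' H' K') ≍
      vcomp (assoc J H K) (hcomp φ (hcomp χ ψ)) := by
  refine trans_heq _ _ (by simp) (by simp) (hcomp_hom_ext ?_)
  intro W t k e
  obtain ⟨V, p, j, h, e₀, _, hp⟩ := exists_cover t
  rw [← cancel_epi p]
  simp [hp, reassoc_of% hp]

theorem lunit_lunitInv {A B : InternalCat E} (M : InternalProf A B) :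
    vcomp (lunit M) (lunitInv M) ≍ id (InternalProf.hcomp (InternalProf.hunit A) M) := by
  refine trans_heq _ _ (by simp) (by simp) (hcomp_hom_ext ?_)
  intro W a m e
  have := tens_bal (J := InternalProf.hunit A) (H := M) (a ≫ A.src ≫ A.unit) a m (by simp) e
  simp only [hunit_ra, ← Category.assoc, unit_comp] at this
  simp only [vcomp_hom, id_hom, Category.comp_id]
  rw [← Category.assoc, tens_lunit, comp_lunitInv, this]
  exact tens_congr _ (by simp) rfl

theorem lunitInv_lunit {A B : InternalCat E} (M : InternalProf A B) :
    vcomp (lunitInv M) (lunit M) ≍ id M := by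
  refine trans_heq _ _ (by simp) (by simp) ?_
  rw [← Category.id_comp (InternalTrans.hom _)]
  simp only [vcomp_hom, id_hom, comp_lunitInv_assoc, tens_lunit]
  simp only [← Category.assoc, la_unit]

theorem lunit_natural {A B C D : InternalCat E} {f : A ⟶ C} {g : B ⟶ D} {M : InternalProf A B}
    {N : InternalProf C D} (φ : Trans f g M N) :
    vcomp (hcomp (hunit f) φ) (lunit N) ≍ vcomp (lunit M) φ := by
  refine trans_heq _ _ (by simp) (by simp) (hcomp_hom_ext ?_)
  intro W a m e
  simp only [vcomp_hom, tens_hcomp_assoc, tens_lunit_assoc]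
  rw [la_hom]
  exact tens_lunit _ _ _ _

theorem runit_runitInv {A B : InternalCat E} (M : InternalProf A B) :
    vcomp (runit M) (runitInv M) ≍ id (InternalProf.hcomp M (InternalProf.hunit B)) := by
  refine trans_heq _ _ (by simp) (by simp) (hcomp_hom_ext ?_)
  intro W m b e
  have := tens_bal (J := M) (H := InternalProf.hunit B) m b (b ≫ B.tgt ≫ B.unit) e (by simp)
  simp only [hunit_la, ← Category.assoc, comp_unit] at this
  simp only [vcomp_hom, id_hom, Category.comp_id]
  rw [← Category.assoc, tens_runit, comp_runitInv, ← this]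
  exact tens_congr _ rfl (by simp)

theorem runitInv_runit {A B : InternalCat E} (M : InternalProf A B) :
    vcomp (runitInv M) (runit M) ≍ id M := by
  refine trans_heq _ _ (by simp) (by simp) ?_
  rw [← Category.id_comp (InternalTrans.hom _)]
  simp only [vcomp_hom, id_hom, comp_runitInv_assoc, tens_runit]
  simp only [← Category.assoc, ra_unit]

theorem runit_natural {A B C D : InternalCat E} {f : A ⟶ C} {g : B ⟶ D} {M : InternalProf A B}
    {N : InternalProf C D} (φ : Trans f g M N) :
    vcomp (hcomp φ (hunit g)) (runit N) ≍ vcomp (runit M) φ := by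
  refine trans_heq _ _ (by simp) (by simp) (hcomp_hom_ext ?_)
  intro W m b e
  simp only [vcomp_hom, tens_hcomp_assoc, tens_runit_assoc]
  rw [ra_hom]
  exact tens_runit _ _ _ _

theorem pentagon {A B C D X : InternalCat E} (J : InternalProf A B) (H : InternalProf B C)
    (K : InternalProf C D) (L : InternalProf D X) :
    vcomp (vcomp (hcomp (assoc J H K) (id L)) (assoc J (InternalProf.hcomp H K) L))
        (hcomp (id J) (assoc H K L)) ≍
      vcomp (assoc (InternalProf.hcomp J H) K L) (assoc J H (InternalProf.hcomp K L)) := by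
  refine trans_heq _ _ (by simp) (by simp) (hcomp_hom_ext ?_)
  intro W t l e
  obtain ⟨V, p, s, k, e₀, _, hp⟩ := exists_cover t
  obtain ⟨U, q, j, h, e₁, _, hq⟩ := exists_cover s
  rw [← cancel_epi p, ← cancel_epi q]
  simp [hp, hq, reassoc_of% hp]

theorem triangle {A B C : InternalCat E} (J : InternalProf A B) (H : InternalProf B C) :
    vcomp (assoc J (InternalProf.hunit B) H) (hcomp (id J) (lunit H)) ≍
      hcomp (runit J) (id H) := by
  refine trans_heq _ _ (by simp) (by simp) (hcomp_hom_ext ?_)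
  intro W t l e
  obtain ⟨V, p, j, b, e₀, _, hp⟩ := exists_cover t
  have e₁ : b ≫ B.tgt = (p ≫ l) ≫ H.left := by
    rw [Category.assoc, ← e, ← Category.assoc, hp, tens_right]
  rw [← cancel_epi p]
  simp only [vcomp_hom, comp_tens_assoc, comp_tens, hp, reassoc_of% hp, tens_hcomp, tens_assoc_assoc, tens_lunit,
    tens_runit, id_hom, Category.comp_id]
  exact (tens_bal _ _ _ e₀ e₁).symm

end InternalTrans

end Laws

/-- The double category of categories, functors, profunctors and transformations internal
in `E`. -/
def profDoubleCategory (E : Type u) [Category.{v} E] [HasPullbacks E] [HasCoequalizers E]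
    [CoequalizersPreservedByPullback E] : DoubleCategory.{max u v, v, max u v, v} where
  Obj := InternalCat E
  Hor := InternalProf
  Cell := Trans
  vid J := InternalTrans.id J
  vcomp φ ψ := InternalTrans.vcomp φ ψ
  vid_vcomp φ := InternalTrans.trans_heq _ _ (by simp) (by simp) (Category.id_comp φ.hom)
  vcomp_vid φ := InternalTrans.trans_heq _ _ (by simp) (by simp) (Category.comp_id φ.hom)
  vcomp_assoc φ ψ χ := InternalTrans.trans_heq _ _ (by simp) (by simp)
    (Category.assoc φ.hom ψ.hom χ.hom)
  hunit A := InternalProf.hunit A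
  hunitCell f := InternalTrans.hunit f
  hunitCell_id _ := InternalTrans.ext rfl
  hunitCell_comp _ _ := InternalTrans.ext rfl
  hcomp J H := InternalProf.hcomp J H
  hcompCell φ χ := InternalTrans.hcomp φ χ
  hcompCell_vid J H := InternalTrans.hcomp_id J H
  interchange φ χ ψ ξ := InternalTrans.interchange φ χ ψ ξ
  assoc J H K := InternalTrans.assoc J H K
  assocInv J H K := InternalTrans.assocInv J H K
  assoc_assocInv := InternalTrans.assoc_assocInv
  assocInv_assoc := InternalTrans.assocInv_assoc
  assoc_natural φ χ ψ := InternalTrans.assoc_natural φ χ ψ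
  lunit M := InternalTrans.lunit M
  lunitInv M := InternalTrans.lunitInv M
  lunit_lunitInv := InternalTrans.lunit_lunitInv
  lunitInv_lunit := InternalTrans.lunitInv_lunit
  lunit_natural := InternalTrans.lunit_natural
  runit M := InternalTrans.runit M
  runitInv M := InternalTrans.runitInv M
  runit_runitInv := InternalTrans.runit_runitInv
  runitInv_runit := InternalTrans.runitInv_runit
  runit_natural := InternalTrans.runit_natural
  pentagon J H K L := InternalTrans.pentagon J H K L
  triangle J H := InternalTrans.triangle J H

section Equipment

attribute [local simp] pullback.lift_fst pullback.lift_fst_assoc pullback.lift_snd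
  pullback.lift_snd_assoc

section

variable {E : Type u} [Category.{v} E] [HasPullbacks E] {A C : InternalCat E} {X : E}

theorem lift_mul (a b : X ⟶ A.mor) (h : a ≫ A.tgt = b ≫ A.src) :
    pullback.lift a b h ≫ A.mul = A.comp a b h := rfl

theorem lift_mul_assoc (a b : X ⟶ A.mor) (h : a ≫ A.tgt = b ≫ A.src) {Z : E} (z : A.mor ⟶ Z) :
    pullback.lift a b h ≫ A.mul ≫ z = A.comp a b h ≫ z := by
  rw [← Category.assoc, lift_mul]

theorem comp_eq_right {u : X ⟶ A.obj} {a b : X ⟶ A.mor} (h : a ≫ A.tgt = b ≫ A.src)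
    (ha : a = u ≫ A.unit) : A.comp a b h = b := by
  subst ha
  exact unit_comp _ _ _

theorem comp_eq_left {u : X ⟶ A.obj} {a b : X ⟶ A.mor} (h : a ≫ A.tgt = b ≫ A.src)
    (hb : b = u ≫ A.unit) : A.comp a b h = a := by
  subst hb
  exact comp_unit _ _ _

theorem comp_assoc (a b c : X ⟶ A.mor) (h : a ≫ A.tgt = b ≫ A.src)
    (h' : A.comp a b h ≫ A.tgt = c ≫ A.src) :
    A.comp (A.comp a b h) c h' =
      A.comp a (A.comp b c (by simpa using h')) (by simpa using h) :=
  A.mul_assoc a b c h (by simpa using h')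

theorem id_frame (X : InternalCat E) : (𝟙 X ≫ 𝟙 X) ≫ 𝟙 X = 𝟙 X := by simp

attribute [local simp] lift_mul lift_mul_assoc

/-- The companion `f_* = A₀ ×_{C₀} C` of an internal functor. -/
abbrev companionProf (f : A ⟶ C) : InternalProf A C where
  apex := pullback f.obj C.src
  left := pullback.fst _ _
  right := pullback.snd _ _ ≫ C.tgt
  lact := pullback.lift (pullback.fst _ _ ≫ A.src)
    (C.comp (pullback.fst _ _ ≫ f.mor) (pullback.snd _ _ ≫ pullback.snd _ _)
      (by simp [pullback.condition_assoc, pullback.condition])) (by simp)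
  ract := pullback.lift (pullback.fst _ _ ≫ pullback.fst _ _)
    (C.comp (pullback.fst _ _ ≫ pullback.snd _ _) (pullback.snd _ _)
      (by simpa using pullback.condition)) (by simp [pullback.condition])
  lact_left := by simp
  lact_right := by simp
  ract_left := by simp
  ract_right := by simp
  unit_lact := by
    intro X j
    apply pullback.hom_ext
    · simp
    · simp only [comp_lift, pullback.lift_snd, InternalCat.comp_comp]
      simp only [pullback.lift_fst_assoc, pullback.lift_snd_assoc]
      exact comp_eq_right (u := j ≫ pullback.fst _ _ ≫ f.obj) _ (by simp)
  ract_unit := by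
    intro X j
    apply pullback.hom_ext
    · simp
    · simp only [comp_lift, Category.assoc, pullback.lift_snd, InternalCat.comp_comp]
      simp only [pullback.lift_fst_assoc]
      exact comp_eq_left (u := j ≫ pullback.snd _ _ ≫ C.tgt) _ (by simp)
  mul_lact := by
    intro X a a' j h h'
    apply pullback.hom_ext
    · simp
    · simp [comp_assoc]
  ract_mul := by
    intro X a a' j h h'
    apply pullback.hom_ext
    · simp
    · simp [comp_assoc]
  lact_ract := by
    intro X a a' j h h'
    apply pullback.hom_ext
    · simp
    · simp [comp_assoc]

/-- The conjoint `f^* = C ×_{C₀} A₀` of an internal functor. -/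
abbrev conjointProf (f : A ⟶ C) : InternalProf C A where
  apex := pullback C.tgt f.obj
  left := pullback.fst _ _ ≫ C.src
  right := pullback.snd _ _
  lact := pullback.lift
    (C.comp (pullback.fst _ _) (pullback.snd _ _ ≫ pullback.fst _ _)
      (by simpa using pullback.condition))
    (pullback.snd _ _ ≫ pullback.snd _ _) (by simp [pullback.condition])
  ract := pullback.lift
    (C.comp (pullback.fst _ _ ≫ pullback.fst _ _) (pullback.snd _ _ ≫ f.mor)
      (by simp [← pullback.condition_assoc, pullback.condition]))
    (pullback.snd _ _ ≫ A.tgt) (by simp)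
  lact_left := by simp
  lact_right := by simp
  ract_left := by simp
  ract_right := by simp
  unit_lact := by
    intro X j
    apply pullback.hom_ext
    · simp only [comp_lift, Category.assoc, pullback.lift_fst, InternalCat.comp_comp]
      simp only [pullback.lift_fst, pullback.lift_snd_assoc]
      exact comp_eq_right (u := j ≫ pullback.fst _ _ ≫ C.src) _ (by simp)
    · simp
  ract_unit := by
    intro X j
    apply pullback.hom_ext
    · simp only [comp_lift, Category.assoc, pullback.lift_fst, InternalCat.comp_comp]
      simp only [pullback.lift_fst_assoc, pullback.lift_snd_assoc]
      exact comp_eq_left (u := j ≫ pullback.snd _ _ ≫ f.obj) _ (by simp)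
    · simp
  mul_lact := by
    intro X a a' j h h'
    apply pullback.hom_ext
    · simp [comp_assoc]
    · simp
  ract_mul := by
    intro X a a' j h h'
    apply pullback.hom_ext
    · simp [comp_assoc]
    · simp
  lact_ract := by
    intro X a a' j h h'
    apply pullback.hom_ext
    · simp [comp_assoc]
    · simp

/-- The companion cell `f_* ⇒ 1_C`. -/
def companionε (f : A ⟶ C) : Trans f (𝟙 C) (companionProf f) (InternalProf.hunit C) :=
  InternalTrans.mk' (K := InternalProf.hunit C) (pullback.snd f.obj C.src)
    (pullback.condition.symm) (by simp [companionProf])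
    (by intros; simp [InternalProf.la])
    (by intros; simp [InternalProf.ra])

/-- The companion cell `1_A ⇒ f_*`. -/
def companionη (f : A ⟶ C) : Trans (𝟙 A) f (InternalProf.hunit A) (companionProf f) :=
  InternalTrans.mk' (J := InternalProf.hunit A)
    (pullback.lift A.src f.mor (by simp) : A.mor ⟶ pullback f.obj C.src)
    (by simp [companionProf]) (by simp [companionProf])
    (by
      intro X a j h
      apply pullback.hom_ext <;> simp [InternalProf.la])
    (by
      intro X a j h
      apply pullback.hom_ext <;> simp [InternalProf.ra])

/-- The conjoint cell `f^* ⇒ 1_C`. -/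
def conjointε (f : A ⟶ C) : Trans (𝟙 C) f (conjointProf f) (InternalProf.hunit C) :=
  InternalTrans.mk' (K := InternalProf.hunit C) (pullback.fst C.tgt f.obj)
    (by simp [conjointProf]) pullback.condition
    (by intros; simp [InternalProf.la])
    (by intros; simp [InternalProf.ra])

/-- The conjoint cell `1_A ⇒ f^*`. -/
def conjointη (f : A ⟶ C) : Trans f (𝟙 A) (InternalProf.hunit A) (conjointProf f) :=
  InternalTrans.mk' (J := InternalProf.hunit A)
    (pullback.lift f.mor A.tgt (by simp) : A.mor ⟶ pullback C.tgt f.obj)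
    (by simp [conjointProf]) (by simp [conjointProf])
    (by
      intro X a j h
      apply pullback.hom_ext <;> simp [InternalProf.la])
    (by
      intro X a j h
      apply pullback.hom_ext <;> simp [InternalProf.ra])

end

section

variable {E : Type u} [Category.{v} E] [HasPullbacks E] [HasCoequalizers E]
  [CoequalizersPreservedByPullback E] {A C : InternalCat E}

theorem left_snake_hom {M : InternalProf A C} {f : A ⟶ C}
    (η : Trans (𝟙 A) f (InternalProf.hunit A) M) (ε : Trans f (𝟙 C) M (InternalProf.hunit C)) :
    (InternalTrans.vcomp (InternalTrans.vcomp (InternalTrans.lunitInv M)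
      (InternalTrans.hcomp η ε)) (InternalTrans.runit M)).hom =
        M.ra ((M.left ≫ A.unit) ≫ η.hom) ε.hom (by simpa using ε.hom_left.symm) := by
  rw [← Category.id_comp (InternalTrans.hom _)]
  simp only [InternalTrans.vcomp_hom, Category.assoc, InternalTrans.comp_lunitInv_assoc]
  rw [InternalTrans.tens_hcomp_assoc]
  refine (InternalTrans.tens_runit M _ _ _).trans ?_
  congr 1 <;> simp

theorem right_snake_hom {M : InternalProf C A} {f : A ⟶ C}
    (η : Trans f (𝟙 A) (InternalProf.hunit A) M) (ε : Trans (𝟙 C) f M (InternalProf.hunit C)) :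
    (InternalTrans.vcomp (InternalTrans.vcomp (InternalTrans.runitInv M)
      (InternalTrans.hcomp ε η)) (InternalTrans.lunit M)).hom =
        M.la ε.hom ((M.right ≫ A.unit) ≫ η.hom) (by simpa using ε.hom_right) := by
  rw [← Category.id_comp (InternalTrans.hom _)]
  simp only [InternalTrans.vcomp_hom, Category.assoc, InternalTrans.comp_runitInv_assoc]
  rw [InternalTrans.tens_hcomp_assoc]
  refine (InternalTrans.tens_lunit M _ _ _).trans ?_
  congr 1 <;> simp

theorem companion_hor_eq (f : A ⟶ C) :
    InternalTrans.vcomp (InternalTrans.vcomp (InternalTrans.lunitInv (companionProf f))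
      (InternalTrans.hcomp (companionη f) (companionε f)))
      (InternalTrans.runit (companionProf f)) ≍ InternalTrans.id (companionProf f) := by
  refine InternalTrans.trans_heq _ _ (by simp) (by simp) ((left_snake_hom _ _).trans ?_)
  change pullback.lift _ _ _ ≫ pullback.lift _ _ _ = 𝟙 (pullback f.obj C.src)
  rw [comp_lift]
  apply pullback.hom_ext
  · rw [pullback.lift_fst, pullback.lift_fst_assoc, Category.id_comp]
    change ((pullback.fst f.obj C.src ≫ A.unit) ≫ pullback.lift A.src f.mor _) ≫
      pullback.fst f.obj C.src = _
    simp
  · rw [pullback.lift_snd, InternalCat.comp_comp, Category.id_comp]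
    refine (comp_eq_right (u := pullback.fst f.obj C.src ≫ f.obj) _ ?_).trans
      (pullback.lift_snd _ _ _)
    rw [pullback.lift_fst_assoc]
    change ((pullback.fst f.obj C.src ≫ A.unit) ≫ pullback.lift A.src f.mor _) ≫
      pullback.snd f.obj C.src = _
    simp

theorem conjoint_hor_eq (f : A ⟶ C) :
    InternalTrans.vcomp (InternalTrans.vcomp (InternalTrans.runitInv (conjointProf f))
      (InternalTrans.hcomp (conjointε f) (conjointη f)))
      (InternalTrans.lunit (conjointProf f)) ≍ InternalTrans.id (conjointProf f) := by
  refine InternalTrans.trans_heq _ _ (by simp) (by simp) ((right_snake_hom _ _).trans ?_)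
  change pullback.lift _ _ _ ≫ pullback.lift _ _ _ = 𝟙 (pullback C.tgt f.obj)
  rw [comp_lift]
  apply pullback.hom_ext
  · rw [pullback.lift_fst, InternalCat.comp_comp, Category.id_comp]
    refine (comp_eq_left (u := pullback.snd C.tgt f.obj ≫ f.obj) _ ?_).trans
      (pullback.lift_fst _ _ _)
    rw [pullback.lift_snd_assoc]
    change ((pullback.snd C.tgt f.obj ≫ A.unit) ≫ pullback.lift f.mor A.tgt _) ≫
      pullback.fst C.tgt f.obj = _
    simp
  · rw [pullback.lift_snd, pullback.lift_snd_assoc, Category.id_comp]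
    change ((pullback.snd C.tgt f.obj ≫ A.unit) ≫ pullback.lift f.mor A.tgt _) ≫
      pullback.snd C.tgt f.obj = _
    simp

/-- The companion of an internal functor. -/
def companion (f : A ⟶ C) :
    DoubleCategory.Companion (𝕂 := profDoubleCategory E) (A := A) (C := C) f where
  hor := companionProf f
  ε := companionε f
  η := companionη f
  vert_eq := ⟨Category.id_comp f, Category.comp_id f,
    InternalTrans.trans_heq (InternalTrans.vcomp (companionη f) (companionε f))
      (InternalTrans.hunit f) (Category.id_comp f) (Category.comp_id f) (pullback.lift_snd _ _ _)⟩
  hor_eq := ⟨id_frame A, id_frame C, companion_hor_eq f⟩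

/-- The conjoint of an internal functor. -/
def conjoint (f : A ⟶ C) :
    DoubleCategory.Conjoint (𝕂 := profDoubleCategory E) (A := A) (C := C) f where
  hor := conjointProf f
  ε := conjointε f
  η := conjointη f
  vert_eq := ⟨Category.comp_id f, Category.id_comp f,
    InternalTrans.trans_heq (InternalTrans.vcomp (conjointη f) (conjointε f))
      (InternalTrans.hunit f) (Category.comp_id f) (Category.id_comp f) (pullback.lift_fst _ _ _)⟩
  hor_eq := ⟨id_frame C, id_frame A, conjoint_hor_eq f⟩

end

end Equipment

/-- The equipment `Prof(E)` of categories, functors, profunctors and transformations internal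
in `E`. -/
def profEquipment (E : Type u) [Category.{v} E] [HasPullbacks E] [HasCoequalizers E]
    [CoequalizersPreservedByPullback E] : Equipment.{max u v, v, max u v, v} where
  toDoubleCategory := profDoubleCategory E
  companion f := companion f
  conjoint f := conjoint f

end InProf

end

/-! Read an element `j` of `J` as a heteromorphism from `left j` in `A` to `right j` in `B`. The
tabulation is then the category whose objects are these heteromorphisms and whose morphisms `j ⟶ k`
are commutative squares: `a : left j ⟶ left k` in `A` and `b : right j ⟶ right k` in `B` with `a · k
= j · b`. Internally, the object of objects is `J.apex`, and the object of morphisms is the pullback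
of the two action maps of `J`. Everything is checked on generalised elements, so each verification
is the set-theoretic one. The cell `π` sends a square to its common diagonal `a · k = j · b`.

Two facts carry the proof. The first is of Yoneda type (`unit_hom_la`, `unit_hom_ra`): a cell `φ :
1_X ⇒ L` with vertical boundaries `f` and `g` is determined by its values on identities, since `f x
· φ(1_t) = φ x = φ(1_s) · g x` for every `x : s ⟶ t`. The second (`unit_tabulationCell`) is that `π`
has the identity squares as a section: the diagonal of the identity square on `j` is `1 · j = j`.

One-dimensional property: for `φ : 1_X ⇒ J` the displayed equation is itself a square with diagonal
`φ x`, and these squares form the functor `X ⟶ ⟨J⟩`. The section shows that a factorisation must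
send an object `x` to `φ(1_x)`; the boundaries then fix it on morphisms.

Two-dimensional property: under the unitors, `m` goes to `m ⊗ 1` or to `1 ⊗ m`, so the two pasted
composites send `m` to `ξA m · ψ(1)` and `φ(1) · ξB m` (`pasteRight_hom`, `pasteLeft_hom`). If `φ`
and `ψ` factor through functors `F` and `G`, the values on identities are `F (left m)` and `G (right
m)`. Equality of the two pastings thus says exactly that `(ξA m, ξB m)` is a square from `F (left
m)` to `G (right m)`.

Opcartesianness: the factorisation of `χ : 1_⟨J⟩ ⇒ L` has to be `j ↦ χ(1_j)`, by the section. It is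
equivariant because `x` and `a · x` are joined by a square with an identity on one side, and
likewise `y` and `y · b`. -/

namespace InProf

noncomputable section

attribute [local simp] pullback.lift_fst pullback.lift_fst_assoc pullback.lift_snd
  pullback.lift_snd_assoc

/-! ### Commutative squares in a profunctor and their composition -/

section Tabulation

variable {E : Type u} [Category.{v} E] [HasPullbacks E] {A B : InternalCat E}
  (J : InternalProf A B) {X W : E}

namespace InternalProf

/-- The compatibility proof carried by `J.la` mentions both elements, so equations between elements
are substituted through this lemma, and for the right action through `ra_congr`. -/
theorem la_congr {J : InternalProf A B} {a a' : X ⟶ A.mor} {j j' : X ⟶ J.apex}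
    (h : a ≫ A.tgt = j ≫ J.left) (ha : a = a') (hj : j = j') :
    J.la a j h = J.la a' j' (by rw [← ha, ← hj, h]) := by
  subst ha hj
  rfl

theorem ra_congr {J : InternalProf A B} {j j' : X ⟶ J.apex} {b b' : X ⟶ B.mor}
    (h : j ≫ J.right = b ≫ B.src) (hj : j = j') (hb : b = b') :
    J.ra j b h = J.ra j' b' (by rw [← hj, ← hb, h]) := by
  subst hj hb
  rfl

/-- The object of morphisms of the tabulation: its elements are the commutative squares
`a · k = j · b`, regarded as morphisms from `j` to `k`. -/
abbrev Sq : E := pullback J.lact J.ract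

namespace Sq

/-- The morphism of `A` in a square. -/
def fstMor : J.Sq ⟶ A.mor := pullback.fst J.lact J.ract ≫ pullback.fst _ _

/-- The target of a square. -/
def cod : J.Sq ⟶ J.apex := pullback.fst J.lact J.ract ≫ pullback.snd _ _

/-- The source of a square. -/
def dom : J.Sq ⟶ J.apex := pullback.snd J.lact J.ract ≫ pullback.fst _ _

/-- The morphism of `B` in a square. -/
def sndMor : J.Sq ⟶ B.mor := pullback.snd J.lact J.ract ≫ pullback.snd _ _

theorem fstMor_tgt : fstMor J ≫ A.tgt = cod J ≫ J.left := by
  simp only [fstMor, cod, Category.assoc, pullback.condition]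

theorem sndMor_src : sndMor J ≫ B.src = dom J ≫ J.right := by
  simp only [sndMor, dom, Category.assoc, pullback.condition]

/-- This is the commutativity of the outer pullback: the generic square has one diagonal, seen from
either action. -/
theorem la_eq_ra : J.la (fstMor J) (cod J) (fstMor_tgt J) =
    J.ra (dom J) (sndMor J) (sndMor_src J).symm := by
  simp only [la, ra, fstMor, cod, dom, sndMor, lift_eta, pullback.condition]

/-- The inner pullbacks impose only two of the four boundary conditions of a square. This one and
`sndMor_tgt` come from taking the left and right legs of the diagonal, since acting on one side
moves only the corresponding leg. -/
theorem fstMor_src : fstMor J ≫ A.src = dom J ≫ J.left := by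
  simpa using congrArg (fun z => z ≫ J.left) (la_eq_ra J)

theorem sndMor_tgt : sndMor J ≫ B.tgt = cod J ≫ J.right := by
  simpa using congrArg (fun z => z ≫ J.right) (la_eq_ra J).symm

variable {J}

theorem comp_la_eq_ra (s : X ⟶ J.Sq) :
    J.la (s ≫ fstMor J) (s ≫ cod J) (by simp only [Category.assoc, fstMor_tgt]) =
      J.ra (s ≫ dom J) (s ≫ sndMor J) (by simp only [Category.assoc, sndMor_src]) := by
  rw [← comp_la _ _ _ (fstMor_tgt J), la_eq_ra, comp_ra]

/-- The square with given components. -/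
def mk (a : X ⟶ A.mor) (k j : X ⟶ J.apex) (b : X ⟶ B.mor) (ak : a ≫ A.tgt = k ≫ J.left)
    (jb : j ≫ J.right = b ≫ B.src) (e : J.la a k ak = J.ra j b jb) : X ⟶ J.Sq :=
  pullback.lift (pullback.lift a k ak) (pullback.lift j b jb) e

section

variable (a : X ⟶ A.mor) (k j : X ⟶ J.apex) (b : X ⟶ B.mor) (ak : a ≫ A.tgt = k ≫ J.left)
    (jb : j ≫ J.right = b ≫ B.src) (e : J.la a k ak = J.ra j b jb)

@[simp] theorem mk_fstMor : mk a k j b ak jb e ≫ fstMor J = a :=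
  (pullback.lift_fst_assoc _ _ _ _).trans (pullback.lift_fst _ _ _)

@[simp] theorem mk_cod : mk a k j b ak jb e ≫ cod J = k :=
  (pullback.lift_fst_assoc _ _ _ _).trans (pullback.lift_snd _ _ _)

@[simp] theorem mk_dom : mk a k j b ak jb e ≫ dom J = j :=
  (pullback.lift_snd_assoc _ _ _ _).trans (pullback.lift_fst _ _ _)

@[simp] theorem mk_sndMor : mk a k j b ak jb e ≫ sndMor J = b :=
  (pullback.lift_snd_assoc _ _ _ _).trans (pullback.lift_snd _ _ _)

end

/-- A square has no data beyond its four sides, so laws about squares reduce to laws in `A`, in `B`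
and in `J.apex`. -/
theorem hom_ext {s t : X ⟶ J.Sq} (h₁ : s ≫ fstMor J = t ≫ fstMor J)
    (h₂ : s ≫ cod J = t ≫ cod J) (h₃ : s ≫ dom J = t ≫ dom J)
    (h₄ : s ≫ sndMor J = t ≫ sndMor J) : s = t := by
  simp only [fstMor, cod, dom, sndMor] at h₁ h₂ h₃ h₄
  apply pullback.hom_ext <;> apply pullback.hom_ext <;> simpa

/-- The composite of two squares. -/
def comp (s t : X ⟶ J.Sq) (h : s ≫ cod J = t ≫ dom J) : X ⟶ J.Sq :=
  mk (A.comp (s ≫ fstMor J) (t ≫ fstMor J)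
      (by simp only [Category.assoc, fstMor_tgt, fstMor_src, reassoc_of% h]))
    (t ≫ cod J) (s ≫ dom J)
    (B.comp (s ≫ sndMor J) (t ≫ sndMor J)
      (by simp only [Category.assoc, sndMor_tgt, sndMor_src, reassoc_of% h]))
    (by simp [fstMor_tgt]) (by simp [sndMor_src])
    (by
      -- Pasting of squares. For `s = (a, b) : j ⟶ k` and `t = (a', b') : k ⟶ l`, one has `(a a') ·
      -- l = a · (a' · l) = a · (k · b') = (a · k) · b' = (j · b) · b' = j · (b b')`. The middle
      -- step is the commutation of the two actions.
      rw [la_comp, ← ra_ra (h := by simp [sndMor_src])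
        (h' := by simp [sndMor_tgt, sndMor_src, reassoc_of% h])]
      rw [la_congr _ rfl (comp_la_eq_ra t), ← ra_congr _ (comp_la_eq_ra s) rfl, ra_la]
      · exact la_congr _ rfl (ra_congr _ h.symm rfl)
      · simp [sndMor_src, reassoc_of% h])

section

variable (s t : X ⟶ J.Sq) (h : s ≫ cod J = t ≫ dom J)

@[simp] theorem comp_fstMor : comp s t h ≫ fstMor J =
    A.comp (s ≫ fstMor J) (t ≫ fstMor J)
      (by simp only [Category.assoc, fstMor_tgt, fstMor_src, reassoc_of% h]) := by
  simp [comp]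

@[simp] theorem comp_cod : comp s t h ≫ cod J = t ≫ cod J := by simp [comp]

@[simp] theorem comp_dom : comp s t h ≫ dom J = s ≫ dom J := by simp [comp]

@[simp] theorem comp_sndMor : comp s t h ≫ sndMor J =
    B.comp (s ≫ sndMor J) (t ≫ sndMor J)
      (by simp only [Category.assoc, sndMor_tgt, sndMor_src, reassoc_of% h]) := by
  simp [comp]

theorem comp_comp (w : W ⟶ X) : w ≫ comp s t h =
    comp (w ≫ s) (w ≫ t) (by simp only [Category.assoc, h]) := by
  apply Sq.hom_ext <;> simp

end

variable (J)

/-- The identity square. -/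
def unit : J.apex ⟶ J.Sq :=
  mk (J.left ≫ A.unit) (𝟙 _) (𝟙 _) (J.right ≫ B.unit) (by simp) (by simp)
    (by rw [la_unit, ra_unit])

@[simp] theorem unit_fstMor : unit J ≫ fstMor J = J.left ≫ A.unit := by simp [unit]

@[simp] theorem unit_cod : unit J ≫ cod J = 𝟙 _ := by simp [unit]

@[simp] theorem unit_dom : unit J ≫ dom J = 𝟙 _ := by simp [unit]

@[simp] theorem unit_sndMor : unit J ≫ sndMor J = J.right ≫ B.unit := by simp [unit]

/-- The left-hand side is the multiplication of `tabulation` evaluated at a composable pair.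
Naturality of `comp` carries the universal pair to any pair, so the category laws can be checked
side by side with `Sq.hom_ext`. -/
theorem lift_comp (s t : X ⟶ J.Sq) (h : s ≫ cod J = t ≫ dom J) :
    pullback.lift s t h ≫ comp (pullback.fst (cod J) (dom J)) (pullback.snd (cod J) (dom J))
      pullback.condition = comp s t h := by
  rw [comp_comp]
  simp

end Sq

/-! ### The tabulation as an internal category, its projections and its cell -/

open Sq

/-- The tabulation of an internal profunctor `J`: its objects are the elements of `J`, and its
morphisms `j ⟶ k` are the pairs `(a, b)` with `a · k = j · b`. -/
abbrev tabulation : InternalCat E where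
  obj := J.apex
  mor := J.Sq
  src := dom J
  tgt := cod J
  mul := comp (pullback.fst _ _) (pullback.snd _ _) pullback.condition
  unit := unit J
  mul_src := comp_dom _ _ pullback.condition
  mul_tgt := comp_cod _ _ pullback.condition
  unit_src := unit_dom J
  unit_tgt := unit_cod J
  unit_mul s := by
    rw [lift_comp]
    apply Sq.hom_ext
    · rw [comp_fstMor]
      -- The side in `A` of the identity square on `dom s` is the identity of the object `left (dom
      -- s)`, which is the value given to `u`. The three analogous steps below name the object in
      -- the same way.
      exact comp_eq_right (u := s ≫ dom J ≫ J.left) _ (by simp)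
    · simp
    · simp
    · rw [comp_sndMor]
      exact comp_eq_right (u := s ≫ dom J ≫ J.right) _ (by simp)
  mul_unit s := by
    rw [lift_comp]
    apply Sq.hom_ext
    · rw [comp_fstMor]
      exact comp_eq_left (u := s ≫ cod J ≫ J.left) _ (by simp)
    · simp
    · simp
    · rw [comp_sndMor]
      exact comp_eq_left (u := s ≫ cod J ≫ J.right) _ (by simp)
  mul_assoc r s t h h' := by
    simp only [lift_comp]
    apply Sq.hom_ext <;> simp [comp_assoc]

/-- This passes from the composition of an abstract internal category to that of squares, where the
sides of a composite are known. -/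
theorem tabulation_comp (s t : X ⟶ J.Sq) (h : s ≫ cod J = t ≫ dom J) :
    J.tabulation.comp s t h = comp s t h :=
  lift_comp J s t h

/-- The projection of the tabulation to the source. -/
def tabulationFst : J.tabulation ⟶ A :=
  show InternalFunctor J.tabulation A from
  { obj := J.left
    mor := fstMor J
    mor_src := fstMor_src J
    mor_tgt := fstMor_tgt J
    unit_mor := unit_fstMor J
    mul_mor := comp_fstMor _ _ pullback.condition }

/-- The projection of the tabulation to the target. -/
def tabulationSnd : J.tabulation ⟶ B :=
  show InternalFunctor J.tabulation B from
  { obj := J.right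
    mor := sndMor J
    mor_src := sndMor_src J
    mor_tgt := sndMor_tgt J
    unit_mor := unit_sndMor J
    mul_mor := comp_sndMor _ _ pullback.condition }

@[simp] theorem tabulationFst_obj : InternalFunctor.obj J.tabulationFst = J.left := rfl

@[simp] theorem tabulationFst_mor : InternalFunctor.mor J.tabulationFst = fstMor J := rfl

@[simp] theorem tabulationSnd_obj : InternalFunctor.obj J.tabulationSnd = J.right := rfl

@[simp] theorem tabulationSnd_mor : InternalFunctor.mor J.tabulationSnd = sndMor J := rfl

/-- The cell defining the tabulation, which sends a square to its diagonal. -/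
def tabulationCell :
    Trans J.tabulationFst J.tabulationSnd (InternalProf.hunit J.tabulation) J :=
  InternalTrans.mk' (J := InternalProf.hunit J.tabulation)
    (J.la (fstMor J) (cod J) (fstMor_tgt J))
    (by simpa using fstMor_src J) (by simp)
    (by
      intro X s t h
      simp only [hunit_la, tabulation_comp, comp_la, comp_fstMor, comp_cod]
      exact la_comp _ _ _ _ _)
    (by
      intro X s t h
      -- For the right action the diagonal is read as `j · b` instead of `a · k`, so that
      -- compatibility is associativity of the action of `B`.
      simp only [hunit_ra, tabulation_comp, la_eq_ra, comp_ra, comp_sndMor, comp_dom]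
      exact (ra_ra _ _ _ _ _).symm)

@[simp] theorem tabulationCell_hom :
    (tabulationCell J).hom = J.la (fstMor J) (cod J) (fstMor_tgt J) := rfl

/-- The diagonal of the identity square on `j` is `1 · j = j`. This section of the cell determines
factorisations on objects in the one-dimensional property, and gives uniqueness of factorisations
through the opcartesian cell. -/
theorem unit_tabulationCell : unit J ≫ (tabulationCell J).hom = 𝟙 J.apex := by
  simp only [tabulationCell_hom, comp_la, unit_fstMor, unit_cod, la_unit]

end InternalProf

end Tabulation

/-! ### Cells out of a horizontal unit, and the one-dimensional property -/

section UniversalProperty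

open InternalProf InternalProf.Sq

variable {E : Type u} [Category.{v} E] [HasPullbacks E] {A B : InternalCat E}
  {J : InternalProf A B}

theorem trans_hom_heq {A B C D : InternalCat E} {f f' : A ⟶ C} {g g' : B ⟶ D}
    {J : InternalProf A B} {K : InternalProf C D} {φ : Trans f g J K} {ψ : Trans f' g' J K}
    (hf : f = f') (hg : g = g') (h : φ ≍ ψ) : φ.hom = ψ.hom := by
  subst hf hg
  rw [eq_of_heq h]

/-- Write `x` as `x` composed with the identity of its target and use equivariance of `φ` for the
left action. A cell out of a unit is thereby determined by its values on identities; `unit_hom_ra`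
does the same with the identity of the source. -/
theorem unit_hom_la {X C D : InternalCat E} {L : InternalProf C D} {f : X ⟶ C} {g : X ⟶ D}
    (φ : Trans f g (InternalProf.hunit X) L) {W : E} (x : W ⟶ X.mor) :
    L.la (x ≫ InternalFunctor.mor f) ((x ≫ X.tgt ≫ X.unit) ≫ φ.hom) (by simp) = x ≫ φ.hom := by
  have h := φ.la_hom (J := InternalProf.hunit X) x (x ≫ X.tgt ≫ X.unit) (by simp)
  rw [← h, hunit_la, comp_eq_left (u := x ≫ X.tgt) _ (by simp)]

theorem unit_hom_ra {X C D : InternalCat E} {L : InternalProf C D} {f : X ⟶ C} {g : X ⟶ D}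
    (φ : Trans f g (InternalProf.hunit X) L) {W : E} (x : W ⟶ X.mor) :
    L.ra ((x ≫ X.src ≫ X.unit) ≫ φ.hom) (x ≫ InternalFunctor.mor g) (by simp) = x ≫ φ.hom := by
  have h := φ.ra_hom (J := InternalProf.hunit X) (x ≫ X.src ≫ X.unit) x (by simp)
  rw [← h, hunit_ra, comp_eq_right (u := x ≫ X.src) _ (by simp)]

/-- The functor into the tabulation induced by a cell out of a horizontal unit. -/
def tabulationLift {X : InternalCat E} {f : X ⟶ A} {g : X ⟶ B}
    (φ : Trans f g (InternalProf.hunit X) J) : X ⟶ J.tabulation :=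
  show InternalFunctor X J.tabulation from
  { obj := X.unit ≫ φ.hom
    mor := Sq.mk (InternalFunctor.mor f) ((X.tgt ≫ X.unit) ≫ φ.hom)
      ((X.src ≫ X.unit) ≫ φ.hom) (InternalFunctor.mor g) (by simp) (by simp)
      -- The square commutes because both of its composites are `φ x`, taken at the generic morphism
      -- `x = 𝟙`.
      (by simpa using (unit_hom_la φ (𝟙 _)).trans (unit_hom_ra φ (𝟙 _)).symm)
    mor_src := by simp
    mor_tgt := by simp
    unit_mor := by apply Sq.hom_ext <;> simp
    mul_mor := by
      refine InternalFunctor.mul_mor_of_comp (A := X) (C := J.tabulation)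
        (by simp [pullback.condition_assoc]) ?_
      rw [tabulation_comp]
      apply Sq.hom_ext <;> simp }

theorem tabulationLift_fst {X : InternalCat E} {f : X ⟶ A} {g : X ⟶ B}
    (φ : Trans f g (InternalProf.hunit X) J) : tabulationLift φ ≫ J.tabulationFst = f :=
  InternalFunctor.ext (show (X.unit ≫ φ.hom) ≫ J.left = _ by simp) (mk_fstMor _ _ _ _ _ _ _)

theorem tabulationLift_snd {X : InternalCat E} {f : X ⟶ A} {g : X ⟶ B}
    (φ : Trans f g (InternalProf.hunit X) J) : tabulationLift φ ≫ J.tabulationSnd = g :=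
  InternalFunctor.ext (show (X.unit ≫ φ.hom) ≫ J.right = _ by simp) (mk_sndMor _ _ _ _ _ _ _)

theorem tabulationLift_hom {X : InternalCat E} {f : X ⟶ A} {g : X ⟶ B}
    (φ : Trans f g (InternalProf.hunit X) J) :
    InternalFunctor.mor (tabulationLift φ) ≫ (tabulationCell J).hom = φ.hom := by
  change Sq.mk _ _ _ _ _ _ _ ≫ _ = _
  simpa using unit_hom_la φ (𝟙 _)

/-- A functor preserves identities and the cell sends the identity square on `j` back to `j`, so
evaluating the factorisation on identities recovers `F` on objects. -/
theorem obj_eq_of_hom {X : InternalCat E} {f : X ⟶ A} {g : X ⟶ B}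
    {φ : Trans f g (InternalProf.hunit X) J} {F : X ⟶ J.tabulation}
    (h : InternalFunctor.mor F ≫ (tabulationCell J).hom = φ.hom) :
    InternalFunctor.obj F = X.unit ≫ φ.hom := by
  rw [← h, InternalFunctor.unit_mor_assoc, unit_tabulationCell, Category.comp_id]

/-- Functors into the tabulation are determined by their composites with its projections and
its cell. -/
theorem eq_tabulationLift {X : InternalCat E} {f : X ⟶ A} {g : X ⟶ B}
    {φ : Trans f g (InternalProf.hunit X) J} {F : X ⟶ J.tabulation}
    (hf : F ≫ J.tabulationFst = f) (hg : F ≫ J.tabulationSnd = g)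
    (h : InternalFunctor.mor F ≫ (tabulationCell J).hom = φ.hom) : F = tabulationLift φ := by
  have ho := obj_eq_of_hom h
  refine InternalFunctor.ext ho ?_
  -- The sides in `A` and `B` are prescribed by the projections; the source and target of the square
  -- are values of `F` on objects, already known from `ho`.
  apply Sq.hom_ext
  · refine (congrArg InternalFunctor.mor hf).trans (mk_fstMor _ _ _ _ _ _ _).symm
  · refine ((InternalFunctor.mor_tgt F).trans ?_).trans (mk_cod _ _ _ _ _ _ _).symm
    rw [ho, Category.assoc]
  · refine ((InternalFunctor.mor_src F).trans ?_).trans (mk_dom _ _ _ _ _ _ _).symm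
    rw [ho, Category.assoc]
  · refine (congrArg InternalFunctor.mor hg).trans (mk_sndMor _ _ _ _ _ _ _).symm

/-! ### Cells into the horizontal unit of the tabulation -/

/-- The cell into the horizontal unit of the tabulation induced by a compatible pair of cells. -/
def tabulationCellLift {X Y : InternalCat E} {H : InternalProf X Y} {F : X ⟶ J.tabulation}
    {G : Y ⟶ J.tabulation}
    (ξA : Trans (F ≫ J.tabulationFst) (G ≫ J.tabulationFst) H (InternalProf.hunit A))
    (ξB : Trans (F ≫ J.tabulationSnd) (G ≫ J.tabulationSnd) H (InternalProf.hunit B))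
    (e : J.la ξA.hom (H.right ≫ InternalFunctor.obj G) (by simpa using ξA.hom_right) =
      J.ra (H.left ≫ InternalFunctor.obj F) ξB.hom (by simpa using ξB.hom_left.symm)) :
    Trans F G H (InternalProf.hunit J.tabulation) :=
  -- The underlying map sends `m` to the square from `F (left m)` to `G (right m)` with sides `ξA m`
  -- and `ξB m`; all four components are read off from `e`, which is its commutativity. Equivariance
  -- is then that of `ξA` and `ξB`, together with the boundaries of a composite.
  InternalTrans.mk' (K := InternalProf.hunit J.tabulation) (Sq.mk _ _ _ _ _ _ e)
    (mk_dom _ _ _ _ _ _ _) (mk_cod _ _ _ _ _ _ _)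
    (by
      intro W x j h
      rw [hunit_la, tabulation_comp]
      apply Sq.hom_ext
      · simp
      · simp
      · simp [show InternalFunctor.mor F ≫ dom J = _ from InternalFunctor.mor_src F]
      · simp only [Category.assoc, mk_sndMor, comp_sndMor]
        exact ξB.la_hom x j h)
    (by
      intro W j x h
      rw [hunit_ra, tabulation_comp]
      apply Sq.hom_ext
      · simp only [Category.assoc, mk_fstMor, comp_fstMor]
        exact ξA.ra_hom j x h
      · simp [show InternalFunctor.mor G ≫ cod J = _ from InternalFunctor.mor_tgt G]
      · simp
      · simp only [Category.assoc, mk_sndMor, comp_sndMor]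
        exact ξB.ra_hom j x h)

/-! ### Factorisation through the cell of the tabulation -/

section Desc

variable {C D : InternalCat E} {h : A ⟶ C} {k : B ⟶ D} {L : InternalProf C D}
  (χ : Trans (J.tabulationFst ≫ h) (J.tabulationSnd ≫ k) (InternalProf.hunit J.tabulation) L)

/-- The data `(a, b)` form a morphism `y ⟶ x` of the tabulation. Both sides are the value of `χ` on
it, computed from the identity at the target and from the identity at the source. -/
theorem la_unit_hom_eq_ra_unit_hom {X : E} (a : X ⟶ A.mor) (x y : X ⟶ J.apex) (b : X ⟶ B.mor)
    (ax : a ≫ A.tgt = x ≫ J.left) (yb : y ≫ J.right = b ≫ B.src)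
    (e : J.la a x ax = J.ra y b yb)
    (h₁ : (a ≫ InternalFunctor.mor h) ≫ C.tgt = (x ≫ unit J ≫ χ.hom) ≫ L.left)
    (h₂ : (y ≫ unit J ≫ χ.hom) ≫ L.right = (b ≫ InternalFunctor.mor k) ≫ D.src) :
    L.la (a ≫ InternalFunctor.mor h) (x ≫ unit J ≫ χ.hom) h₁ =
      L.ra (y ≫ unit J ≫ χ.hom) (b ≫ InternalFunctor.mor k) h₂ := by
  refine Eq.trans (la_congr _ ?_ ?_) ((unit_hom_la χ (Sq.mk a x y b ax yb e)).trans
    ((unit_hom_ra χ (Sq.mk a x y b ax yb e)).symm.trans (ra_congr _ ?_ ?_)))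
  · simp [reassoc_of% mk_fstMor a x y b ax yb e]
  · simp [reassoc_of% mk_cod a x y b ax yb e]
  · simp [reassoc_of% mk_dom a x y b ax yb e]
  · simp [reassoc_of% mk_sndMor a x y b ax yb e]

theorem unit_hom_left : (unit J ≫ χ.hom) ≫ L.left = J.left ≫ InternalFunctor.obj h := by
  rw [Category.assoc, χ.hom_left]
  change unit J ≫ dom J ≫ J.left ≫ InternalFunctor.obj h = _
  rw [← Category.assoc, unit_dom, Category.id_comp]

theorem unit_hom_right : (unit J ≫ χ.hom) ≫ L.right = J.right ≫ InternalFunctor.obj k := by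
  rw [Category.assoc, χ.hom_right]
  change unit J ≫ cod J ≫ J.right ≫ InternalFunctor.obj k = _
  rw [← Category.assoc, unit_cod, Category.id_comp]

/-- The cell out of `J` induced by a cell out of the horizontal unit of its tabulation. -/
def tabulationDesc : Trans h k J L :=
  InternalTrans.mk' (unit J ≫ χ.hom) (unit_hom_left χ) (unit_hom_right χ)
    (by
      intro X a x e
      -- Apply the lemma to the morphism `a · x ⟶ x` given by the square `a · x = (a · x) · 1`. It
      -- yields `h a · χ(1_x) = χ(1_{a · x}) · k 1`, and `k 1` is an identity and acts trivially.
      rw [la_unit_hom_eq_ra_unit_hom χ a x (J.la a x e) ((x ≫ J.right) ≫ B.unit) e (by simp)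
        (ra_unit _ _ _).symm _ (by
          rw [Category.assoc, unit_hom_right]
          simp)]
      refine Eq.trans (ra_unit _ (x ≫ J.right ≫ InternalFunctor.obj k) ?_).symm
        (ra_congr _ rfl (by simp))
      rw [Category.assoc, unit_hom_right]
      simp)
    (by
      intro X y b e
      -- Dually, the morphism `y ⟶ y · b` is given by the square `1 · (y · b) = y · b`.
      rw [← la_unit_hom_eq_ra_unit_hom χ ((y ≫ J.left) ≫ A.unit) (J.ra y b e) y b (by simp) e
        (la_unit _ _ _) (by
          rw [Category.assoc (J.ra y b e), unit_hom_left]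
          simp) _]
      refine Eq.trans (la_unit (y ≫ J.left ≫ InternalFunctor.obj h) _ ?_).symm
        (la_congr _ (by simp) rfl)
      rw [Category.assoc (J.ra y b e), unit_hom_left]
      simp)

@[simp] theorem tabulationDesc_hom : (tabulationDesc χ).hom = unit J ≫ χ.hom := rfl

/-- On a square with diagonal `a · k`, equivariance of the induced cell gives `h a · χ(1_k)`, which
by `unit_hom_la` is the value of `χ` on that square. -/
theorem tabulationCell_desc : (tabulationCell J).hom ≫ (tabulationDesc χ).hom = χ.hom := by
  rw [tabulationCell_hom, InternalTrans.la_hom]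
  simpa using unit_hom_la χ (𝟙 _)

/-- Precompose the equation with the section of `unit_tabulationCell`. -/
theorem eq_tabulationDesc {ψ : Trans h k J L} (e : (tabulationCell J).hom ≫ ψ.hom = χ.hom) :
    ψ = tabulationDesc χ := by
  apply InternalTrans.ext
  rw [tabulationDesc_hom, ← e, ← Category.assoc, unit_tabulationCell, Category.id_comp]

end Desc

/-! ### Pasted composites on elements -/

section Paste

variable [HasCoequalizers E] [CoequalizersPreservedByPullback E] {X Y : InternalCat E}
  {H : InternalProf X Y}

/-- Followed on elements, the composite is `m ↦ m ⊗ 1 ↦ ξ m ⊗ ψ(1) ↦ ξ m · ψ(1)`, the identity being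
that of `right m`. Only the value of `ψ` on identities enters, and no tensor product remains. In
`pasteLeft_hom` the path is `m ↦ 1 ⊗ m ↦ φ(1) ⊗ ξ m ↦ φ(1) · ξ m`. -/
theorem pasteRight_hom {f : X ⟶ A} {g : Y ⟶ A} {k : Y ⟶ B}
    (ξ : Trans f g H (InternalProf.hunit A)) (ψ : Trans g k (InternalProf.hunit Y) J) :
    (InternalTrans.vcomp (InternalTrans.vcomp (InternalTrans.runitInv H)
      (InternalTrans.hcomp ξ ψ)) (InternalTrans.lunit J)).hom =
        J.la ξ.hom (H.right ≫ Y.unit ≫ ψ.hom) (by simpa using ξ.hom_right) := by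
  -- Precomposing with the identity makes the map act on the generic element of `H`, to which the
  -- formulas for unitors and tensors apply.
  rw [← Category.id_comp (InternalTrans.hom _)]
  simp only [InternalTrans.vcomp_hom, Category.assoc, InternalTrans.comp_runitInv_assoc]
  rw [InternalTrans.tens_hcomp_assoc]
  refine (InternalTrans.tens_lunit J _ _ _).trans (la_congr _ ?_ ?_) <;> simp

theorem pasteLeft_hom {f : X ⟶ A} {g : X ⟶ B} {k : Y ⟶ B}
    (φ : Trans f g (InternalProf.hunit X) J) (ξ : Trans g k H (InternalProf.hunit B)) :
    (InternalTrans.vcomp (InternalTrans.vcomp (InternalTrans.lunitInv H)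
      (InternalTrans.hcomp φ ξ)) (InternalTrans.runit J)).hom =
        J.ra (H.left ≫ X.unit ≫ φ.hom) ξ.hom (by simpa using ξ.hom_left.symm) := by
  rw [← Category.id_comp (InternalTrans.hom _)]
  simp only [InternalTrans.vcomp_hom, Category.assoc, InternalTrans.comp_lunitInv_assoc]
  rw [InternalTrans.tens_hcomp_assoc]
  refine (InternalTrans.tens_runit J _ _ _).trans (ra_congr _ ?_ ?_) <;> simp

end Paste

end UniversalProperty

/-! ### The universal properties in the double category -/

section Equipment

open InternalProf InternalProf.Sq

variable {E : Type u} [Category.{v} E] [HasPullbacks E] [HasCoequalizers E]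
  [CoequalizersPreservedByPullback E] {A B : InternalCat E} (J : InternalProf A B)

/-- Once the vertical boundaries agree, a cell is determined by its underlying map; this turns the
heterogeneous equalities of the universal property into equations in `E`. -/
theorem sameCell_iff {A B C D : InternalCat E} {f f' : A ⟶ C} {g g' : B ⟶ D}
    {J : InternalProf A B} {K : InternalProf C D} (φ : Trans f g J K) (ψ : Trans f' g' J K) :
    DoubleCategory.SameCell (𝕂 := profDoubleCategory E) (A := A) (B := B) (C := C) (D := D)
      (J := J) (K := K) (f := f) (f' := f') (g := g) (g' := g') φ ψ ↔
      f = f' ∧ g = g' ∧ φ.hom = ψ.hom :=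
  ⟨fun ⟨hf, hg, h⟩ => ⟨hf, hg, trans_hom_heq hf hg h⟩,
    fun ⟨hf, hg, h⟩ => ⟨hf, hg, InternalTrans.trans_heq _ _ hf hg h⟩⟩

/-- This is the two-dimensional property with the cells `φ` and `ψ` replaced by their factorisations
through `F` and `G`. All vertical boundaries then match on the nose, and the last condition can be
stated on underlying maps. -/
theorem tabulation_two_dim {X Y : InternalCat E} {H : InternalProf X Y}
    (F : X ⟶ J.tabulation) (G : Y ⟶ J.tabulation)
    (ξA : Trans (F ≫ J.tabulationFst) (G ≫ J.tabulationFst) H (InternalProf.hunit A))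
    (ξB : Trans (F ≫ J.tabulationSnd) (G ≫ J.tabulationSnd) H (InternalProf.hunit B))
    (e : InternalTrans.vcomp (InternalTrans.vcomp (InternalTrans.runitInv H)
        (InternalTrans.hcomp ξA (InternalTrans.vcomp (InternalTrans.hunit G) (tabulationCell J))))
        (InternalTrans.lunit J) =
      InternalTrans.vcomp (InternalTrans.vcomp (InternalTrans.lunitInv H)
        (InternalTrans.hcomp (InternalTrans.vcomp (InternalTrans.hunit F) (tabulationCell J)) ξB))
        (InternalTrans.runit J)) :
    ∃! ξ : Trans F G H (InternalProf.hunit J.tabulation),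
      ξ.hom ≫ fstMor J = ξA.hom ∧ ξ.hom ≫ sndMor J = ξB.hom := by
  have e' := congrArg InternalTrans.hom e
  rw [pasteRight_hom, pasteLeft_hom] at e'
  -- By the section, the cell factored through `F` takes the value `F x` on the identity of `x`, and
  -- similarly for `G`. With these values `e'` becomes the commutativity `ξA m · G (right m) = F
  -- (left m) · ξB m` required by `tabulationCellLift`.
  have hF : X.unit ≫ InternalFunctor.mor F ≫ (tabulationCell J).hom = InternalFunctor.obj F := by
    rw [InternalFunctor.unit_mor_assoc, unit_tabulationCell, Category.comp_id]
  have hG : Y.unit ≫ InternalFunctor.mor G ≫ (tabulationCell J).hom = InternalFunctor.obj G := by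
    rw [InternalFunctor.unit_mor_assoc, unit_tabulationCell, Category.comp_id]
  simp only [InternalTrans.vcomp_hom, InternalTrans.hunit_hom, hF, hG] at e'
  refine ⟨tabulationCellLift ξA ξB e', ⟨mk_fstMor _ _ _ _ _ _ _, mk_sndMor _ _ _ _ _ _ _⟩, ?_⟩
  rintro ξ ⟨hA, hB⟩
  apply InternalTrans.ext
  -- The two sides are fixed by `hA` and `hB`; the source and target of the square are forced by the
  -- vertical boundaries `F` and `G` of the cell.
  apply Sq.hom_ext
  · exact hA.trans (mk_fstMor _ _ _ _ _ _ _).symm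
  · exact ξ.hom_right.trans (mk_cod _ _ _ _ _ _ _).symm
  · exact ξ.hom_left.trans (mk_dom _ _ _ _ _ _ _).symm
  · exact hB.trans (mk_sndMor _ _ _ _ _ _ _).symm

theorem isTabulation_tabulationCell :
    DoubleCategory.IsTabulation (𝕂 := profDoubleCategory E) (A := A) (B := B)
      (T := J.tabulation) (J := J) (πA := J.tabulationFst) (πB := J.tabulationSnd)
      (tabulationCell J) where
  one_dim X f g φ := by
    refine ⟨tabulationLift φ, ?_, ?_⟩
    · exact (sameCell_iff (InternalTrans.vcomp (InternalTrans.hunit (tabulationLift φ))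
        (tabulationCell J)) φ).2 ⟨tabulationLift_fst φ, tabulationLift_snd φ,
          tabulationLift_hom φ⟩
    · intro F hF
      obtain ⟨hf, hg, h⟩ := (sameCell_iff (InternalTrans.vcomp (InternalTrans.hunit F)
        (tabulationCell J)) φ).1 hF
      exact eq_tabulationLift hf hg h
  two_dim X Y φA φB ψA ψB φ ψ F G hφ hψ H ξA ξB e := by
    -- The factorisations are strict, so the boundaries of `φ` and `ψ`, and then the cells
    -- themselves, can be replaced by composites with the tabulating cell. This leaves the situation
    -- of `tabulation_two_dim`.
    obtain ⟨rfl, rfl, hφ⟩ := hφ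
    obtain ⟨rfl, rfl, hψ⟩ := hψ
    obtain rfl := eq_of_heq hφ
    obtain rfl := eq_of_heq hψ
    obtain ⟨ξ, ⟨hA, hB⟩, hξ⟩ := tabulation_two_dim J F G ξA ξB e
    refine ⟨ξ, ⟨(sameCell_iff (InternalTrans.vcomp ξ (InternalTrans.hunit J.tabulationFst))
      ξA).2 ⟨rfl, rfl, hA⟩, (sameCell_iff (InternalTrans.vcomp ξ
        (InternalTrans.hunit J.tabulationSnd)) ξB).2 ⟨rfl, rfl, hB⟩⟩, ?_⟩
    rintro ξ' ⟨hA', hB'⟩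
    exact hξ ξ' ⟨((sameCell_iff (InternalTrans.vcomp ξ' (InternalTrans.hunit J.tabulationFst))
      ξA).1 hA').2.2, ((sameCell_iff (InternalTrans.vcomp ξ'
        (InternalTrans.hunit J.tabulationSnd)) ξB).1 hB').2.2⟩

theorem isOpcartesian_tabulationCell :
    DoubleCategory.IsOpcartesian (𝕂 := profDoubleCategory E) (A := J.tabulation)
      (B := J.tabulation) (C := A) (D := B) (f := J.tabulationFst) (g := J.tabulationSnd)
      (J := InternalProf.hunit J.tabulation) (K := J) (tabulationCell J) :=
  fun _ _ _ _ _ χ => ⟨tabulationDesc χ, InternalTrans.ext (tabulationCell_desc χ),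
    fun _ hψ => eq_tabulationDesc χ (congrArg InternalTrans.hom hψ)⟩

end Equipment

end

end InProf

theorem mainTheorem4 {E : Type u} [Category.{v} E] [HasPullbacks E] [HasCoequalizers E]
    [CoequalizersPreservedByPullback E] {A B : (InProf.profEquipment E).Obj}
    (J : (InProf.profEquipment E).Hor A B) :
    ∃ (T : (InProf.profEquipment E).Obj) (πA : T ⟶ A) (πB : T ⟶ B)
      (π : (InProf.profEquipment E).Cell πA πB ((InProf.profEquipment E).hunit T) J),
      DoubleCategory.IsTabulation (𝕂 := (InProf.profEquipment E).toDoubleCategory) π ∧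
        DoubleCategory.IsOpcartesian (𝕂 := (InProf.profEquipment E).toDoubleCategory) π :=
  ⟨InProf.InternalProf.tabulation J, InProf.InternalProf.tabulationFst J,
    InProf.InternalProf.tabulationSnd J, InProf.InternalProf.tabulationCell J,
    InProf.isTabulation_tabulationCell J, InProf.isOpcartesian_tabulationCell J⟩
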